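/- **Definitions.** Let $d$ be a finite matrix size and, for a square matrix $A$, let $\operatorname{Im}A=(A-A^\dagger)/2i$. A *matrix Nevanlinna function* is an analytic function $f\colon\mathbb{C}\setminus\mathbb{R}\to\mathbb{C}^{d\times d}$ with $f(z)^\dagger=f(\overline z)$ and $\operatorname{Im}f(z)/\operatorname{Im}z\ge0$ for all $z\in\mathbb{C}\setminus\mathbb{R}$. It is *degenerate* if $\ker\operatorname{Im}f(z)\neq\{0\}$ for all $z\in\mathbb{C}\setminus\mathbb{R}$ and *non-degenerate* if $\ker\operatorname{Im}f(z)=\{0\}$ for all $z\in\mathbb{C}\setminus\mathbb{R}$. A scalar Nevanlinna function is the case $d=1$; it is degenerate if $\operatorname{Im}f$ vanishes at some point of $\mathbb{C}\setminus\mathbb{R}$. For $x\in\mathbb{R}$ and $r\in\{0,1,2,\dots\}\cup\{\infty\}$, $\mathfrak{N}_r(x)$ is the set of Nevanlinna functions $f$ for which the following limits, over real $y\ne0$, exist: $$f^{(0)}(x)=f(x):=\lim_{y\to0}f(x+iy),\qquad f^{(k)}(x):=\lim_{y\to0}\frac{f^{(k-1)}(x+iy)-f^{(k-1)}(x)}{iy},\quad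 1\le k\le r$$ (all $k\ge1$ if $r=\infty$). **Theorem.** *Transformation.* If $f\in\mathfrak{N}_1(0)$ is non-degenerate, then $f(0)$ is Hermitian, $f'(0)$ is positive definite and $f(z)-f(0)$ is invertible for every $z\in\mathbb{C}\setminus\mathbb{R}$, so that, with $f'(0)^{1/2}$ the non-negative definite square root of $f'(0)$, $$\begin{aligned} g(z)&=z^{-1}f'(0)^{-1/2}\,(f(z)-f(0)-f'(0)z)\,(f(z)-f(0))^{-1}\,f'(0)^{1/2}\\&=z^{-1}f'(0)^{1/2}\,(f(z)-f(0))^{-1}\,(f(z)-f(0)-f'(0)z)\,f'(0)^{-1/2}\end{aligned}$$ is well defined on $\mathbb{C}\setminus\mathbb{R}$, the two expressions being equal. Moreover: (i) if $f\in\mathfrak{N}_1(0)$ is non-degenerate, then $g$ is a Nevanlinna function; (ii) if $2\le r\le\infty$ and $f\in\mathfrak{N}_r(0)$ is non-degenerate, then $g\in\mathfrak{N}_{r-2}(0)$ (with $\infty-2=\infty$). *Schur algorithm.* Let $f\in\mathfrak{N}_\infty(0)$. The matrix Schur algorithm is $f_0=f$ and $$f_{n+1}(z)=z^{-1}a_n^{-1}(f_n(z)-b_n-a_n^2z)(f_n(z)-b_n)^{-1}a_n,\qquad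 b_n=f_n(0),\quad a_n^2=f_n'(0),\quad a_n>0,$$ and in the scalar case $$f_{n+1}(z)=\frac1z\,\frac{f_n(z)-b_n-a_n^2z}{f_n(z)-b_n},\qquad b_n=f_n(0),\quad a_n^2=f_n'(0),\quad a_n>0.$$ The step from $f_n$ to $f_{n+1}$ is performed if the normal limit $b_n$ and the normal derivative $f_n'(0)$ exist, $f_n'(0)=a_n^2$ for some $a_n>0$, and $f_n(z)-b_n$ is invertible for every $z\in\mathbb{C}\setminus\mathbb{R}$; otherwise the algorithm stops at $f_n$. In both the scalar and the matrix case every iterate $f_n$ that is generated is a Nevanlinna function, in fact $f_n\in\mathfrak{N}_\infty(0)$. The algorithm stops at $f_n$ if and only if $f_n$ is degenerate, and then $f_n(z)-f_n(0)$ is invertible for no $z\in\mathbb{C}\setminus\mathbb{R}$ (in the scalar case, $f_n(z)=f_n(0)$ for all such $z$). Hence finitely many iterates are generated if a degenerate iterate arises, and infinitely many otherwise. -/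

import Mathlib

open Filter Topology
open scoped MatrixOrder ComplexOrder

noncomputable section

/-- `f` is a matrix valued Nevanlinna function: it is analytic on `ℂ ∖ ℝ`, with `f(z)† = f(z̄)` and
`Im f(z) / Im z ≥ 0` there, where `Im A = (A - A†) / 2i`. Values of `f` on the real line are
irrelevant. -/
structure IsNevanlinna {ι : Type*} [Fintype ι] (f : ℂ → Matrix ι ι ℂ) : Prop where
  analytic : DifferentiableOn ℂ f {z : ℂ | z.im ≠ 0}
  symm : ∀ z : ℂ, z.im ≠ 0 → (f z).conjTranspose = f (starRingEnd ℂ z)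
  nonneg : ∀ z : ℂ, z.im ≠ 0 →
    (((z.im)⁻¹ : ℝ) • (imaginaryPart (f z) : Matrix ι ι ℂ)).PosSemidef

/-- `f` is non-degenerate: `ker Im f(z)` is trivial on `ℂ ∖ ℝ`. -/
def IsNondegenerate {ι : Type*} [Fintype ι] (f : ℂ → Matrix ι ι ℂ) : Prop :=
  ∀ z : ℂ, z.im ≠ 0 →
    ∀ v : ι → ℂ, (imaginaryPart (f z) : Matrix ι ι ℂ).mulVec v = 0 → v = 0

/-- `f` is degenerate: `ker Im f(z)` is non-trivial on `ℂ ∖ ℝ`. -/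
def IsDegenerate {ι : Type*} [Fintype ι] (f : ℂ → Matrix ι ι ℂ) : Prop :=
  ∀ z : ℂ, z.im ≠ 0 →
    ∃ v : ι → ℂ, v ≠ 0 ∧ (imaginaryPart (f z) : Matrix ι ι ℂ).mulVec v = 0

/-- Scalar Nevanlinna functions. -/
structure IsScalarNevanlinna (f : ℂ → ℂ) : Prop where
  analytic : DifferentiableOn ℂ f {z : ℂ | z.im ≠ 0}
  symm : ∀ z : ℂ, z.im ≠ 0 → starRingEnd ℂ (f z) = f (starRingEnd ℂ z)
  nonneg : ∀ z : ℂ, z.im ≠ 0 → 0 ≤ (f z).im / z.im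

/-- A scalar Nevanlinna function is degenerate if `Im f` vanishes somewhere on `ℂ ∖ ℝ`. -/
def IsScalarDegenerate (f : ℂ → ℂ) : Prop :=
  ∃ z : ℂ, z.im ≠ 0 ∧ (f z).im = 0

section Normal

variable {F : Type*} [AddCommGroup F] [Module ℂ F] [TopologicalSpace F]
  [ContinuousSMul ℂ F] [IsTopologicalAddGroup F]

/-- The expression in `y` whose limit as `y → 0` is the `k`-th normal derivative of `f` at `x`;
`d` is the normal derivative of the previous order (not used when `k = 0`). -/
def normalQuotient (f : ℂ → F) (x : ℝ) (d : F) : ℕ → ℝ → F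
  | 0, y => f (x + y * Complex.I)
  | k + 1, y => (y * Complex.I : ℂ)⁻¹ • (deriv^[k] f (x + y * Complex.I) - d)

/-- The `k`-th normal derivative of `f` at the real point `x`:
`f(x) = lim_{y → 0} f(x + iy)` for `k = 0`, and
`f⁽ᵏ⁾(x) = lim_{y → 0} (f⁽ᵏ⁻¹⁾(x + iy) - f⁽ᵏ⁻¹⁾(x)) / iy` for `k ≥ 1`, where `y` is real. It is
meaningful only if the limits exist, see `HasNormalDerivs`. -/
def normalDeriv (f : ℂ → F) (x : ℝ) : ℕ → F
  | 0 => @limUnder _ _ _ ⟨0⟩ (𝓝[≠] (0 : ℝ)) (normalQuotient f x 0 0)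
  | k + 1 => @limUnder _ _ _ ⟨0⟩ (𝓝[≠] (0 : ℝ)) (normalQuotient f x (normalDeriv f x k) (k + 1))

/-- The limits defining the normal derivatives of `f` at `x` of orders `0, …, r` exist (of all
orders if `r = ∞`). -/
def HasNormalDerivs (f : ℂ → F) (x : ℝ) (r : ℕ∞) : Prop :=
  ∀ k : ℕ, (k : ℕ∞) ≤ r → ∃ l : F,
    Tendsto (normalQuotient f x (normalDeriv f x (k - 1)) k) (𝓝[≠] (0 : ℝ)) (𝓝 l)

end Normal

/-- The class `𝔑_r(x)` of matrix valued Nevanlinna functions with `r`-th normal derivative at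
the real point `x`. -/
def nevanlinnaClass (ι : Type*) [Fintype ι] (r : ℕ∞) (x : ℝ) : Set (ℂ → Matrix ι ι ℂ) :=
  {f | IsNevanlinna f ∧ HasNormalDerivs f x r}

/-- The class `𝔑_r(x)` of scalar Nevanlinna functions. -/
def scalarNevanlinnaClass (r : ℕ∞) (x : ℝ) : Set (ℂ → ℂ) :=
  {f | IsScalarNevanlinna f ∧ HasNormalDerivs f x r}

/-- The transformation
`g(z) = z⁻¹ f'(0)^{-1/2} (f(z) - f(0) - f'(0) z) (f(z) - f(0))⁻¹ f'(0)^{1/2}`. -/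
def schurTransform {ι : Type*} [Fintype ι] [DecidableEq ι] (f : ℂ → Matrix ι ι ℂ) (z : ℂ) :
    Matrix ι ι ℂ :=
  let b := normalDeriv f 0 0
  let d := normalDeriv f 0 1
  z⁻¹ • ((CFC.sqrt d)⁻¹ * (f z - b - z • d) * (f z - b)⁻¹ * CFC.sqrt d)

/-- The alternative form
`g(z) = z⁻¹ f'(0)^{1/2} (f(z) - f(0))⁻¹ (f(z) - f(0) - f'(0) z) f'(0)^{-1/2}`. -/
def schurTransform' {ι : Type*} [Fintype ι] [DecidableEq ι] (f : ℂ → Matrix ι ι ℂ) (z : ℂ) :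
    Matrix ι ι ℂ :=
  let b := normalDeriv f 0 0
  let d := normalDeriv f 0 1
  z⁻¹ • (CFC.sqrt d * (f z - b)⁻¹ * (f z - b - z • d) * (CFC.sqrt d)⁻¹)

/-- The scalar transformation `g(z) = z⁻¹ (f(z) - f(0) - f'(0) z) / (f(z) - f(0))`. -/
def scalarSchurTransform (f : ℂ → ℂ) (z : ℂ) : ℂ :=
  z⁻¹ * ((f z - normalDeriv f 0 0 - normalDeriv f 0 1 * z) / (f z - normalDeriv f 0 0))

/-- A step of the matrix Schur algorithm can be performed on `f`: the normal limits `b = f(0)` and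
`f'(0)` exist, `f'(0)` is the square of a positive definite matrix `a`, and `f(z) - b` is invertible
for every `z ∈ ℂ ∖ ℝ`. -/
def SchurStepDefined {ι : Type*} [Fintype ι] [DecidableEq ι] (f : ℂ → Matrix ι ι ℂ) : Prop :=
  HasNormalDerivs f 0 1 ∧
  (∃ a : Matrix ι ι ℂ, a.PosDef ∧ a ^ 2 = normalDeriv f 0 1) ∧
  ∀ z : ℂ, z.im ≠ 0 → IsUnit (f z - normalDeriv f 0 0)

/-- A step of the scalar Schur algorithm can be performed on `f`. -/
def ScalarSchurStepDefined (f : ℂ → ℂ) : Prop :=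
  HasNormalDerivs f 0 1 ∧
  (∃ a : ℝ, 0 < a ∧ (a : ℂ) ^ 2 = normalDeriv f 0 1) ∧
  ∀ z : ℂ, z.im ≠ 0 → f z - normalDeriv f 0 0 ≠ 0

open Classical in
/-- The matrix Schur algorithm started at `f`: `matrixSchurIterate f n` is `some fₙ` if the
algorithm reaches its `n`-th iterate `fₙ`, and `none` if it has stopped before. -/
def matrixSchurIterate {ι : Type*} [Fintype ι] [DecidableEq ι] (f : ℂ → Matrix ι ι ℂ) :
    ℕ → Option (ℂ → Matrix ι ι ℂ)
  | 0 => some f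
  | n + 1 => (matrixSchurIterate f n).bind fun g =>
      if SchurStepDefined g then some (schurTransform g) else none

open Classical in
/-- The scalar Schur algorithm started at `f`, with the same conventions. -/
def scalarSchurIterate (f : ℂ → ℂ) : ℕ → Option (ℂ → ℂ)
  | 0 => some f
  | n + 1 => (scalarSchurIterate f n).bind fun g =>
      if ScalarSchurStepDefined g then some (scalarSchurTransform g) else none

end

/-! Let `b = f(0)`, `d = f'(0)` and `s = d^{1/2}`. Both expressions for the transform reduce to
`g(z) = z⁻¹ - s (f(z) - b)⁻¹ s`. Since `b` is Hermitian, `-(f - b)⁻¹` is again Nevanlinna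
(`neg_inv_sub`). Conjugated by `s`, it behaves like `-z⁻¹` along the normal at `0`. Julia's lemma
(`div_normSq_le_of_tendsto`) says that removing this pole keeps the imaginary part nonnegative,
which gives (i).

Positivity rests on Harnack's inequality applied to the scalar functions `v* f v`. It makes `ker Im
f(z)` independent of `z`, so that degenerate and non-degenerate are complementary, and it bounds `v*
d v` below by `v* Im f(i) v`. A vector in the kernel satisfies `f(z) v = b v`, so `f - b` is nowhere
invertible in the degenerate case. Hence the algorithm stops exactly at degenerate iterates.

For (ii), Taylor's formula along the normal shows that dividing by `z` a function vanishing at `0`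
costs one order (`NormallyDifferentiable.div_id`). This happens twice: in `P = (f - b) / z`, whose
limit `d` is invertible, and in `g = (1 - s P⁻¹ s) / z`, whose numerator tends to `0`. The scalar
case is that of 1 × 1 matrices. -/

noncomputable section

/-! ### Scalar Nevanlinna functions: Schwarz–Pick, Harnack and Julia. -/

section

open Complex ComplexConjugate

theorem tendsto_neg_nhdsNE_zero : Tendsto (fun y : ℝ => -y) (𝓝[≠] 0) (𝓝[≠] 0) := by
  refine tendsto_nhdsWithin_iff.2 ⟨?_, ?_⟩
  · have := (continuous_neg (G := ℝ)).tendsto 0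
    rw [neg_zero] at this
    exact this.mono_left nhdsWithin_le_nhds
  · filter_upwards [self_mem_nhdsWithin] with y hy
    simpa using hy

/-- If `‖A - B‖ ≤ ρ ‖A - B̄‖` for points of the closed upper half plane, then `Im A` is bounded below
by a multiple of `Im B`. -/
theorem im_ge_of_norm_sub_le {A B : ℂ} {ρ : ℝ} (hA : 0 ≤ A.im) (hB : 0 ≤ B.im) (h0 : 0 ≤ ρ)
    (h1 : ρ < 1) (h : ‖A - B‖ ≤ ρ * ‖A - conj B‖) : (1 - ρ) * B.im ≤ (1 + ρ) * A.im := by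
  have h2 : ‖A - B‖ ^ 2 ≤ ρ ^ 2 * ‖A - conj B‖ ^ 2 := by
    rw [← mul_pow]; gcongr
  rw [← normSq_eq_norm_sq, ← normSq_eq_norm_sq, normSq_apply, normSq_apply] at h2
  simp only [sub_re, sub_im, conj_re, conj_im] at h2
  -- Both sides of `h2` contain the square of the difference of the real parts, on the right with
  -- the factor `ρ ^ 2 ≤ 1`, so it can be dropped.
  have h3 : (B.im - A.im) ^ 2 ≤ (ρ * (A.im + B.im)) ^ 2 := by
    have : 0 ≤ (1 - ρ ^ 2) * (A.re - B.re) ^ 2 := by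
      have : ρ ^ 2 ≤ 1 := by nlinarith
      have : 0 ≤ 1 - ρ ^ 2 := by linarith
      positivity
    nlinarith
  have h4 := abs_le_of_sq_le_sq' h3 (by positivity)
  linarith [h4.2]

theorem norm_sub_lt_norm_sub_conj {z w : ℂ} (hz : 0 < z.im) (hw : 0 < w.im) :
    ‖z - w‖ < ‖z - conj w‖ := by
  apply lt_of_pow_lt_pow_left₀ 2 (norm_nonneg _)
  rw [← normSq_eq_norm_sq, ← normSq_eq_norm_sq, normSq_apply, normSq_apply]
  simp only [sub_re, sub_im, conj_re, conj_im]
  nlinarith [mul_pos hz hw]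

/-- The **Schwarz–Pick lemma** for maps from the upper half plane to its closure. -/
theorem schwarzPick_upperHalfPlane {φ : ℂ → ℂ} (hd : DifferentiableOn ℂ φ {z | 0 < z.im})
    (h : ∀ z : ℂ, 0 < z.im → 0 ≤ (φ z).im) {z w : ℂ} (hz : 0 < z.im) (hw : 0 < w.im)
    (hφ : 0 < (φ w).im) :
    ‖φ z - φ w‖ ≤ ‖z - w‖ / ‖z - conj w‖ * ‖φ z - conj (φ w)‖ := by
  have hden : ∀ z : ℂ, 0 < z.im → φ z - conj (φ w) ≠ 0 := fun z hz h0 => by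
    have := congrArg Complex.im h0
    simp at this
    linarith [h z hz]
  -- `T` maps the unit disc into the upper half plane with `T 0 = w`; it inverts the Cayley map `z ↦
  -- (z - w) / (z - conj w)`.
  set T : ℂ → ℂ := fun ζ => (w - conj w * ζ) / (1 - ζ)
  have hne : ∀ ζ ∈ Metric.ball (0 : ℂ) 1, 1 - ζ ≠ 0 := by
    intro ζ hζ h0
    rw [← sub_eq_zero.1 h0] at hζ
    simp at hζ
  have hT : ∀ ζ ∈ Metric.ball (0 : ℂ) 1, 0 < (T ζ).im := by
    intro ζ hζ
    have h1 := hne ζ hζ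
    have h2 : 0 < normSq (1 - ζ) := normSq_pos.2 h1
    have h3 : normSq ζ < 1 := by
      rw [normSq_eq_norm_sq]
      have : ‖ζ‖ < 1 := by simpa using hζ
      nlinarith [norm_nonneg ζ]
    have h4 : (T ζ).im = w.im * (1 - normSq ζ) / normSq (1 - ζ) := by
      simp only [T, div_im]
      rw [← sub_div]
      congr 1
      simp [normSq_apply]
      ring
    rw [h4]
    have : 0 < 1 - normSq ζ := by linarith
    positivity
  -- Composing with the Cayley map centred at `φ w` gives a map from the disc to the closed disc
  -- fixing `0`, to which Schwarz's lemma applies.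
  set ψ : ℂ → ℂ := fun ζ => (φ (T ζ) - φ w) / (φ (T ζ) - conj (φ w))
  have hdψ : DifferentiableOn ℂ ψ (Metric.ball 0 1) := by
    have hTd : DifferentiableOn ℂ T (Metric.ball 0 1) := by
      apply DifferentiableOn.div (by fun_prop) (by fun_prop) hne
    have hφT : DifferentiableOn ℂ (fun ζ => φ (T ζ)) (Metric.ball 0 1) :=
      hd.comp hTd fun ζ hζ => hT ζ hζ
    exact (hφT.sub_const _).div (hφT.sub_const _) fun ζ hζ => hden _ (hT ζ hζ)
  have hmaps : Set.MapsTo ψ (Metric.ball 0 1) (Metric.closedBall 0 1) := by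
    intro ζ hζ
    have h1 := hden _ (hT ζ hζ)
    have h2 := h _ (hT ζ hζ)
    simp only [ψ, Metric.mem_closedBall, dist_zero_right, norm_div]
    apply div_le_one_of_le₀ _ (norm_nonneg _)
    apply le_of_sq_le_sq _ (norm_nonneg _)
    rw [← normSq_eq_norm_sq, ← normSq_eq_norm_sq, normSq_apply, normSq_apply]
    simp only [sub_re, sub_im, conj_re, conj_im]
    nlinarith [mul_nonneg h2 hφ.le]
  have hzw : z - conj w ≠ 0 := fun h0 => by
    have := congrArg Complex.im h0
    simp at this
    linarith
  have hlt := norm_sub_lt_norm_sub_conj hz hw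
  have hball : ‖(z - w) / (z - conj w)‖ < 1 := by
    rw [norm_div, div_lt_one (norm_pos_iff.2 hzw)]
    exact hlt
  have hTz : T ((z - w) / (z - conj w)) = z := by
    have h1 := hne ((z - w) / (z - conj w)) (by simpa using hball)
    simp only [T]
    rw [div_eq_iff h1]
    field_simp
    ring
  have key := norm_le_norm_of_mapsTo_ball hdψ hmaps (by simp [ψ, T]) hball
  simp only [ψ, hTz, norm_div] at key
  rwa [div_le_iff₀ (norm_pos_iff.2 (hden z hz))] at key

/-- **Harnack's inequality** for the imaginary part of a map from the upper half plane to its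
closure. -/
theorem harnack_upperHalfPlane {φ : ℂ → ℂ} (hd : DifferentiableOn ℂ φ {z | 0 < z.im})
    (h : ∀ z : ℂ, 0 < z.im → 0 ≤ (φ z).im) {z w : ℂ} (hz : 0 < z.im) (hw : 0 < w.im) :
    4 * z.im * w.im * (φ w).im ≤ (‖z - conj w‖ + ‖z - w‖) ^ 2 * (φ z).im := by
  -- Schwarz–Pick needs `0 < (φ w).im`; otherwise the left side is zero.
  rcases (h w hw).eq_or_lt with h0 | h0
  · rw [← h0]
    have := h z hz
    simp only [mul_zero]
    positivity
  have hlt := norm_sub_lt_norm_sub_conj hz hw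
  set P := ‖z - conj w‖ with hP
  set Q := ‖z - w‖ with hQ
  have hQ0 : 0 ≤ Q := norm_nonneg _
  have hP0 : 0 < P := by linarith
  have h1 := im_ge_of_norm_sub_le (h z hz) h0.le (by positivity) ((div_lt_one hP0).2 hlt)
    (schwarzPick_upperHalfPlane hd h hz hw h0)
  have h2 : (P - Q) * (φ w).im ≤ (P + Q) * (φ z).im := by
    have := mul_le_mul_of_nonneg_left h1 hP0.le
    have e : P * (Q / P) = Q := by field_simp
    rw [← mul_assoc, ← mul_assoc, mul_sub, mul_add, e] at this
    simpa using this
  -- This identity turns the Harnack constant `(P + Q) / (P - Q)` into a form without division by `P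
  -- - Q`.
  have h3 : 4 * z.im * w.im = (P + Q) * (P - Q) := by
    have : (P + Q) * (P - Q) = P ^ 2 - Q ^ 2 := by ring
    rw [this, hP, hQ, ← normSq_eq_norm_sq, ← normSq_eq_norm_sq, normSq_apply, normSq_apply]
    simp only [sub_re, sub_im, conj_re, conj_im]
    ring
  rw [h3, mul_assoc, pow_two, mul_assoc]
  gcongr

namespace IsScalarNevanlinna

variable {f : ℂ → ℂ} (hf : IsScalarNevanlinna f)
include hf

theorem differentiableOn_upper : DifferentiableOn ℂ f {z | 0 < z.im} :=
  hf.analytic.mono fun _ hz => ne_of_gt hz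

theorem im_nonneg {z : ℂ} (hz : 0 < z.im) : 0 ≤ (f z).im := by
  have := hf.nonneg z hz.ne'
  rw [le_div_iff₀ hz] at this
  simpa using this

theorem im_div_im_conj {z : ℂ} (hz : z.im ≠ 0) :
    (f (conj z)).im / (conj z).im = (f z).im / z.im := by
  rw [← hf.symm z hz]
  simp [neg_div_neg_eq]

theorem im_pos_of_ne {w : ℂ} (hw : 0 < w.im) (h : (f w).im ≠ 0) {z : ℂ} (hz : 0 < z.im) :
    0 < (f z).im := by
  have h1 : 0 < (f w).im := lt_of_le_of_ne (hf.im_nonneg hw) h.symm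
  have h2 := harnack_upperHalfPlane hf.differentiableOn_upper (fun _ => hf.im_nonneg) hz hw
  have h3 : 0 < 4 * z.im * w.im * (f w).im := by positivity
  by_contra! h4
  nlinarith [mul_nonneg (sq_nonneg (‖z - conj w‖ + ‖z - w‖)) (neg_nonneg.2 h4)]

/-- Harnack propagates positivity within the upper half plane, and the reflection symmetry carries
it across the real line. -/
theorem im_div_pos_of_ne {w : ℂ} (hw : w.im ≠ 0) (h : (f w).im ≠ 0) {z : ℂ} (hz : z.im ≠ 0) :
    0 < (f z).im / z.im := by
  have aux : ∀ z : ℂ, z.im ≠ 0 → ∃ z' : ℂ, 0 < z'.im ∧ (f z').im / z'.im = (f z).im / z.im := by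
    intro z hz
    rcases hz.lt_or_gt with h1 | h1
    · exact ⟨conj z, by simpa using h1, hf.im_div_im_conj hz⟩
    · exact ⟨z, h1, rfl⟩
  obtain ⟨w', hw', e1⟩ := aux w hw
  obtain ⟨z', hz', e2⟩ := aux z hz
  rw [← e2]
  refine div_pos (hf.im_pos_of_ne hw' (fun h0 => ?_) hz') hz'
  rw [h0, zero_div] at e1
  exact div_ne_zero h hw e1.symm

/-- A scalar Nevanlinna function whose imaginary part vanishes somewhere is constant. -/
theorem exists_eq_const {w : ℂ} (hw : w.im ≠ 0) (h : (f w).im = 0) :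
    ∃ c : ℝ, ∀ z : ℂ, z.im ≠ 0 → f z = c := by
  have h0 : ∀ z : ℂ, z.im ≠ 0 → (f z).im = 0 := by
    intro z hz
    by_contra h1
    have := hf.im_div_pos_of_ne hz h1 hw
    simp [h] at this
  have hopen : IsOpen {z : ℂ | 0 < z.im} := isOpen_lt continuous_const continuous_im
  have hconn : IsConnected {z : ℂ | 0 < z.im} :=
    ⟨⟨I, by simp⟩, (convex_halfSpace_im_gt 0).isPreconnected⟩
  obtain ⟨c, hc⟩ := AnalyticOnNhd.eq_const_add_im_mul_I_of_re_eq_const (c₀ := 0)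
    (hf.differentiableOn_upper.analyticOnNhd hopen) (fun z hz => h0 z (ne_of_gt hz)) hopen hconn
  simp only [ofReal_zero, zero_mul, add_zero] at hc
  refine ⟨c, fun z hz => ?_⟩
  rcases hz.lt_or_gt with h1 | h1
  · have h2 := hf.symm z hz
    rw [hc (conj z) (by simpa using h1)] at h2
    simpa using congrArg conj h2
  · exact hc z h1

/-- The boundary **Schwarz lemma** of Julia: a mass at `0` may be removed. -/
theorem div_normSq_le_of_tendsto {c : ℝ}
    (h : Tendsto (fun y : ℝ => (y * I : ℂ) * f (y * I)) (𝓝[≠] 0) (𝓝 (-c))) {z : ℂ}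
    (hz : z.im ≠ 0) : c / normSq z ≤ (f z).im / z.im := by
  have aux : ∀ z : ℂ, 0 < z.im → c / normSq z ≤ (f z).im / z.im := by
    intro z hz
    have hn : 0 < normSq z := normSq_pos.2 fun h0 => by simp [h0] at hz
    have hle : 𝓝[>] (0 : ℝ) ≤ 𝓝[≠] 0 := nhdsWithin_mono _ fun y hy => ne_of_gt hy
    -- `h1` and `h2` are the limits as `y → 0` of the two sides of Harnack's inequality with `w =
    -- iy`. The first uses `Re (iy f(iy)) = -y Im f(iy)`.
    have h1 : Tendsto (fun y : ℝ => 4 * z.im * y * (f (y * I)).im) (𝓝[>] 0) (𝓝 (4 * z.im * c)) := by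
      have := ((continuous_re.tendsto _).comp (h.mono_left hle)).const_mul (-(4 * z.im))
      convert this using 2
      · simp; ring
      · simp
    have h2 : Tendsto (fun y : ℝ => (‖z - conj (y * I)‖ + ‖z - y * I‖) ^ 2 * (f z).im) (𝓝[>] 0)
        (𝓝 ((‖z‖ + ‖z‖) ^ 2 * (f z).im)) := by
      have hc : Continuous fun y : ℝ => (‖z - conj (y * I)‖ + ‖z - y * I‖) ^ 2 * (f z).im := by
        fun_prop
      simpa using (hc.tendsto 0).mono_left nhdsWithin_le_nhds
    have h3 := le_of_tendsto_of_tendsto h1 h2 (by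
      filter_upwards [self_mem_nhdsWithin] with y hy
      simpa using harnack_upperHalfPlane hf.differentiableOn_upper (fun _ => hf.im_nonneg) hz
        (w := y * I) (by simpa using hy))
    rw [div_le_div_iff₀ hn hz, normSq_eq_norm_sq]
    nlinarith
  rcases hz.lt_or_gt with h1 | h1
  · have := aux (conj z) (by simpa using h1)
    rwa [hf.im_div_im_conj hz, normSq_conj] at this
  · exact aux z h1

/-- Harnack between `iy` and `i`: the two distances are `1 + y` and `1 - y`, with sum `2`, so the
factors `4` cancel. -/
theorem im_I_le {y : ℝ} (h0 : 0 < y) (h1 : y < 1) : (f I).im ≤ (f (y * I)).im / y := by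
  have h2 := harnack_upperHalfPlane hf.differentiableOn_upper (fun _ => hf.im_nonneg)
    (z := y * I) (w := I) (by simpa using h0) (by simp)
  have h3 : ‖(y * I : ℂ) - conj I‖ = y + 1 := by
    have : (y * I : ℂ) - conj I = ((y + 1 : ℝ) : ℂ) * I := by simp; ring
    rw [this, norm_mul, norm_real, norm_I, Real.norm_of_nonneg (by linarith), mul_one]
  have h4 : ‖(y * I : ℂ) - I‖ = 1 - y := by
    have : (y * I : ℂ) - I = -(((1 - y : ℝ) : ℂ) * I) := by simp; ring
    rw [this, norm_neg, norm_mul, norm_real, norm_I, Real.norm_of_nonneg (by linarith), mul_one]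
  rw [h3, h4] at h2
  rw [le_div_iff₀ h0]
  simp at h2
  nlinarith

/-- The normal derivative of a Nevanlinna function is bounded below. -/
theorem im_I_le_of_tendsto {b d : ℂ} (hb : b.im = 0)
    (h : Tendsto (fun y : ℝ => (y * I : ℂ)⁻¹ * (f (y * I) - b)) (𝓝[≠] 0) (𝓝 d)) :
    (f I).im ≤ d.re := by
  have hle : 𝓝[>] (0 : ℝ) ≤ 𝓝[≠] 0 := nhdsWithin_mono _ fun y hy => ne_of_gt hy
  refine ge_of_tendsto ((continuous_re.tendsto _).comp (h.mono_left hle)) ?_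
  filter_upwards [Ioo_mem_nhdsGT (zero_lt_one' ℝ)] with y hy
  refine (hf.im_I_le hy.1 hy.2).trans_eq ?_
  simp [hb, mul_re]
  ring

end IsScalarNevanlinna

end

/-! ### Calculus of expansions along the normal at `0`. -/

section

open Complex ComplexConjugate

theorem isOpen_im_ne_zero : IsOpen {z : ℂ | z.im ≠ 0} :=
  isOpen_ne_fun continuous_im continuous_const

theorem tendsto_ofReal_mul_I : Tendsto (fun y : ℝ => (y * I : ℂ)) (𝓝[≠] 0) (𝓝 0) := by
  have : Continuous fun y : ℝ => (y * I : ℂ) := by fun_prop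
  simpa using (this.tendsto 0).mono_left nhdsWithin_le_nhds

theorem eventually_ofReal_mul_I_im_ne_zero : ∀ᶠ y : ℝ in 𝓝[≠] 0, (y * I : ℂ).im ≠ 0 := by
  filter_upwards [self_mem_nhdsWithin] with y hy
  simpa using hy

theorem deriv_eqOn_im_ne_zero {f g : ℂ → ℂ} (h : Set.EqOn f g {z : ℂ | z.im ≠ 0}) :
    Set.EqOn (deriv f) (deriv g) {z : ℂ | z.im ≠ 0} := fun _ hz =>
  (h.eventuallyEq_of_mem (isOpen_im_ne_zero.mem_nhds hz)).deriv_eq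

theorem differentiableAt_of_im_ne_zero {f : ℂ → ℂ} (hf : DifferentiableOn ℂ f {z : ℂ | z.im ≠ 0})
    {z : ℂ} (hz : z.im ≠ 0) : DifferentiableAt ℂ f z :=
  hf.differentiableAt (isOpen_im_ne_zero.mem_nhds hz)

/-- `f` has a first order expansion along the normal to the real line at `0`. -/
def HasNormalExpansion (f : ℂ → ℂ) (a b : ℂ) : Prop :=
  Tendsto (fun y : ℝ => f (y * I)) (𝓝[≠] 0) (𝓝 a) ∧
    Tendsto (fun y : ℝ => (y * I : ℂ)⁻¹ * (f (y * I) - a)) (𝓝[≠] 0) (𝓝 b)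

/-- The derivatives of `f` of order less than `n` have first order expansions along the normal to
the real line at `0`. -/
def NormallyDifferentiable : ℕ → (ℂ → ℂ) → Prop
  | 0, _ => True
  | n + 1, f => (∃ a b, HasNormalExpansion f a b) ∧ NormallyDifferentiable n (deriv f)

/-- The derivative of `f` of order `k < n` is `o(y ^ (n - k))` along the normal to the real line
at `0`. -/
def NormallyFlat : ℕ → (ℂ → ℂ) → Prop
  | 0, _ => True
  | n + 1, f => (fun y : ℝ => f (y * I)) =o[𝓝[≠] 0] (fun y : ℝ => y ^ (n + 1)) ∧
      NormallyFlat n (deriv f)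

theorem tendsto_congr_im_ne_zero {f g : ℂ → ℂ} (h : Set.EqOn f g {z : ℂ | z.im ≠ 0}) :
    (fun y : ℝ => f (y * I)) =ᶠ[𝓝[≠] 0] fun y : ℝ => g (y * I) := by
  filter_upwards [eventually_ofReal_mul_I_im_ne_zero] with y hy using h hy

namespace HasNormalExpansion

variable {f g : ℂ → ℂ} {a b c d : ℂ}

theorem congr (hf : HasNormalExpansion f a b) (h : Set.EqOn f g {z : ℂ | z.im ≠ 0}) :
    HasNormalExpansion g a b := by
  refine ⟨hf.1.congr' (tendsto_congr_im_ne_zero h), hf.2.congr' ?_⟩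
  filter_upwards [tendsto_congr_im_ne_zero h] with y hy
  rw [hy]

theorem of_tendsto (h : Tendsto (fun y : ℝ => (y * I : ℂ)⁻¹ * (f (y * I) - a)) (𝓝[≠] 0) (𝓝 b)) :
    HasNormalExpansion f a b := by
  refine ⟨?_, h⟩
  have := (tendsto_ofReal_mul_I.mul h).add_const a
  rw [zero_mul, zero_add] at this
  refine this.congr' ?_
  filter_upwards [self_mem_nhdsWithin] with y hy
  have : (y : ℂ) ≠ 0 := by simpa using hy
  have := I_ne_zero
  field_simp
  ring

theorem add (hf : HasNormalExpansion f a b) (hg : HasNormalExpansion g c d) :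
    HasNormalExpansion (fun z => f z + g z) (a + c) (b + d) := by
  refine ⟨hf.1.add hg.1, (hf.2.add hg.2).congr fun y => ?_⟩
  ring

theorem mul (hf : HasNormalExpansion f a b) (hg : HasNormalExpansion g c d) :
    HasNormalExpansion (fun z => f z * g z) (a * c) (b * c + a * d) := by
  refine ⟨hf.1.mul hg.1, ((hf.2.mul hg.1).add (hg.2.const_mul a)).congr fun y => ?_⟩
  ring

theorem inv (hf : HasNormalExpansion f a b) (ha : a ≠ 0) (h0 : ∀ z : ℂ, z.im ≠ 0 → f z ≠ 0) :
    HasNormalExpansion (fun z => (f z)⁻¹) a⁻¹ (-b * a⁻¹ * a⁻¹) := by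
  have h1 := hf.1.inv₀ ha
  refine ⟨h1, ((hf.2.neg.mul_const a⁻¹).mul h1).congr' ?_⟩
  filter_upwards [eventually_ofReal_mul_I_im_ne_zero] with y hy
  have := h0 _ hy
  have hy0 : (y : ℂ) ≠ 0 := by simpa using hy
  have := I_ne_zero
  field_simp
  ring

theorem of_hasDerivAt (h : HasDerivAt f b 0) : HasNormalExpansion f (f 0) b := by
  apply of_tendsto
  have := h.tendsto_slope.comp (f := fun y : ℝ => (y * I : ℂ)) (x := 𝓝[≠] 0)
    (tendsto_nhdsWithin_iff.2 ⟨tendsto_ofReal_mul_I, by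
      filter_upwards [eventually_ofReal_mul_I_im_ne_zero] with y hy h0
      simp only [Set.mem_singleton_iff] at h0
      simp [h0] at hy⟩)
  refine this.congr fun y => ?_
  simp [slope_def_field, div_eq_inv_mul]

theorem unique (hf : HasNormalExpansion f a b) (hg : HasNormalExpansion f c d) : a = c ∧ b = d := by
  have := tendsto_nhds_unique hf.1 hg.1
  subst this
  exact ⟨rfl, tendsto_nhds_unique hf.2 hg.2⟩

end HasNormalExpansion

/-- A mean value inequality along the normal. -/
theorem isLittleO_normal_of_deriv {h : ℂ → ℂ} (hd : DifferentiableOn ℂ h {z : ℂ | z.im ≠ 0})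
    (h0 : Tendsto (fun y : ℝ => h (y * I)) (𝓝[≠] 0) (𝓝 0)) {n : ℕ}
    (h1 : (fun y : ℝ => deriv h (y * I)) =o[𝓝[≠] 0] (fun y : ℝ => y ^ n)) :
    (fun y : ℝ => h (y * I)) =o[𝓝[≠] 0] (fun y : ℝ => y ^ (n + 1)) := by
  rw [Asymptotics.isLittleO_iff] at h1 ⊢
  intro ε hε
  obtain ⟨δ, hδ, hball⟩ := Metric.mem_nhdsWithin_iff.1 (h1 hε)
  filter_upwards [self_mem_nhdsWithin, mem_nhdsWithin_of_mem_nhds (Metric.ball_mem_nhds 0 hδ)]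
    with y hy hyδ
  have hy0 : y ≠ 0 := hy
  have hyδ' : |y| < δ := by simpa using hyδ
  -- Nothing is known about `h` at `0` itself, so the mean value inequality is used on the segment
  -- from `ty` to `y`, and `t → 0` is taken afterwards by means of `h0`.
  have key : ∀ t ∈ Set.Ioc (0 : ℝ) 1,
      ‖h (y * I) - h ((t * y : ℝ) * I)‖ ≤ ε * ‖y ^ (n + 1)‖ := by
    intro t ht
    have hder : ∀ s ∈ Set.Ioc (0 : ℝ) 1, HasDerivWithinAt (fun s : ℝ => h ((s * y : ℝ) * I))
        (deriv h ((s * y : ℝ) * I) * (y * I)) (Set.Ioc 0 1) s := by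
      intro s hs
      have h2 : ((s * y : ℝ) * I : ℂ).im ≠ 0 := by simpa using ⟨hs.1.ne', hy0⟩
      have h3 := (differentiableAt_of_im_ne_zero hd h2).hasDerivAt
      have h4 : HasDerivAt (fun s : ℝ => ((s * y : ℝ) * I : ℂ)) (y * I) s := by
        have := (((hasDerivAt_id s).mul_const y).ofReal_comp).mul_const I
        simpa using this
      exact (h3.comp s h4).hasDerivWithinAt
    have hbd : ∀ s ∈ Set.Ioc (0 : ℝ) 1,
        ‖deriv h ((s * y : ℝ) * I) * (y * I)‖ ≤ ε * ‖y ^ (n + 1)‖ := by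
      intro s hs
      have hsy : |s * y| ≤ |y| := by
        rw [abs_mul, abs_of_pos hs.1]
        exact mul_le_of_le_one_left (abs_nonneg y) hs.2
      have := hball ⟨by simpa using hsy.trans_lt hyδ', mul_ne_zero hs.1.ne' hy0⟩
      simp only [Set.mem_ofPred_eq] at this
      rw [norm_mul, norm_mul, norm_I, mul_one, norm_real, pow_succ, norm_mul, ← mul_assoc]
      refine mul_le_mul_of_nonneg_right (this.trans ?_) (norm_nonneg _)
      rw [norm_pow, norm_pow]
      exact mul_le_mul_of_nonneg_left (pow_le_pow_left₀ (norm_nonneg _) hsy n) hε.le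
    have := (convex_Ioc (0 : ℝ) 1).norm_image_sub_le_of_norm_hasDerivWithin_le hder hbd ht
      (Set.right_mem_Ioc.2 one_pos)
    rw [one_mul] at this
    refine this.trans (mul_le_of_le_one_right (by positivity) ?_)
    rw [Real.norm_of_nonneg (by linarith [ht.2])]
    linarith [ht.1]
  have hlim : Tendsto (fun t : ℝ => ‖h (y * I) - h ((t * y : ℝ) * I)‖) (𝓝[>] 0)
      (𝓝 ‖h (y * I) - 0‖) := by
    refine ((h0.comp (f := fun t : ℝ => t * y) ?_).const_sub _).norm
    refine tendsto_nhdsWithin_iff.2 ⟨?_, ?_⟩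
    · have : Continuous fun t : ℝ => t * y := by fun_prop
      simpa using (this.tendsto 0).mono_left nhdsWithin_le_nhds
    · filter_upwards [self_mem_nhdsWithin] with t ht
      exact mul_ne_zero (ne_of_gt ht) hy0
  rw [sub_zero] at hlim
  refine le_of_tendsto hlim ?_
  filter_upwards [Ioc_mem_nhdsGT (zero_lt_one' ℝ)] with t ht using key t ht

/-- The normal derivative is the limit of the derivatives. -/
theorem HasNormalExpansion.of_tendsto_deriv {h : ℂ → ℂ} {a b : ℂ}
    (hd : DifferentiableOn ℂ h {z : ℂ | z.im ≠ 0})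
    (h0 : Tendsto (fun y : ℝ => h (y * I)) (𝓝[≠] 0) (𝓝 a))
    (h1 : Tendsto (fun y : ℝ => deriv h (y * I)) (𝓝[≠] 0) (𝓝 b)) : HasNormalExpansion h a b := by
  apply of_tendsto
  -- After subtraction of the affine part the derivative is `o(1)`, which is the case `n = 0` of
  -- `isLittleO_normal_of_deriv`.
  have hd' : DifferentiableOn ℂ (fun z => h z - (a + b * z)) {z : ℂ | z.im ≠ 0} :=
    hd.sub (by fun_prop)
  have e1 : Tendsto (fun y : ℝ => h (y * I) - (a + b * (y * I))) (𝓝[≠] 0) (𝓝 0) := by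
    have := h0.sub ((tendsto_ofReal_mul_I.const_mul b).const_add a)
    simpa using this
  have e2 : (fun y : ℝ => deriv (fun z => h z - (a + b * z)) (y * I)) =o[𝓝[≠] 0]
      (fun y : ℝ => y ^ 0) := by
    simp only [pow_zero]
    rw [Asymptotics.isLittleO_one_iff]
    have := h1.sub_const b
    rw [sub_self] at this
    refine this.congr' ?_
    filter_upwards [eventually_ofReal_mul_I_im_ne_zero] with y hy
    have h2 := (differentiableAt_of_im_ne_zero hd hy).hasDerivAt
    have h3 : HasDerivAt (fun z : ℂ => a + b * z) b (y * I) := by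
      simpa using ((hasDerivAt_id (y * I : ℂ)).const_mul b).const_add a
    exact (h2.sub h3).deriv.symm
  have e3 := isLittleO_normal_of_deriv hd' e1 e2
  have e4 : (fun y : ℝ => h (y * I) - (a + b * (y * I))) =o[𝓝[≠] 0] (fun y : ℝ => (y * I : ℂ)) := by
    refine e3.trans_isBigO (Asymptotics.IsBigO.of_bound 1 (Eventually.of_forall fun y => ?_))
    simp
  have e5 := e4.tendsto_div_nhds_zero.add_const b
  rw [zero_add] at e5
  refine e5.congr' ?_
  filter_upwards [self_mem_nhdsWithin] with y hy
  have : (y : ℂ) ≠ 0 := by simpa using hy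
  have := I_ne_zero
  field_simp
  ring

theorem differentiableOn_deriv_im_ne_zero {f : ℂ → ℂ}
    (hf : DifferentiableOn ℂ f {z : ℂ | z.im ≠ 0}) :
    DifferentiableOn ℂ (deriv f) {z : ℂ | z.im ≠ 0} :=
  hf.deriv isOpen_im_ne_zero

theorem differentiableOn_iterate_deriv_im_ne_zero {f : ℂ → ℂ}
    (hf : DifferentiableOn ℂ f {z : ℂ | z.im ≠ 0}) (k : ℕ) :
    DifferentiableOn ℂ (deriv^[k] f) {z : ℂ | z.im ≠ 0} := by
  induction k with
  | zero => exact hf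
  | succ k ih => rw [Function.iterate_succ_apply']; exact differentiableOn_deriv_im_ne_zero ih

namespace NormallyDifferentiable

theorem congr {n : ℕ} {f g : ℂ → ℂ} (hf : NormallyDifferentiable n f)
    (h : Set.EqOn f g {z : ℂ | z.im ≠ 0}) : NormallyDifferentiable n g := by
  induction n generalizing f g with
  | zero => trivial
  | succ n ih =>
    obtain ⟨⟨a, b, hab⟩, h'⟩ := hf
    exact ⟨⟨a, b, hab.congr h⟩, ih h' (deriv_eqOn_im_ne_zero h)⟩

theorem of_succ {n : ℕ} {f : ℂ → ℂ} (hf : NormallyDifferentiable (n + 1) f) :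
    NormallyDifferentiable n f := by
  induction n generalizing f with
  | zero => trivial
  | succ n ih => exact ⟨hf.1, ih hf.2⟩

theorem add {n : ℕ} {f g : ℂ → ℂ} (hf : NormallyDifferentiable n f)
    (hg : NormallyDifferentiable n g) (hdf : DifferentiableOn ℂ f {z : ℂ | z.im ≠ 0})
    (hdg : DifferentiableOn ℂ g {z : ℂ | z.im ≠ 0}) :
    NormallyDifferentiable n (fun z => f z + g z) := by
  induction n generalizing f g with
  | zero => trivial
  | succ n ih =>
    obtain ⟨⟨a, b, hab⟩, hf'⟩ := hf
    obtain ⟨⟨c, d, hcd⟩, hg'⟩ := hg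
    refine ⟨⟨_, _, hab.add hcd⟩, (ih hf' hg' (differentiableOn_deriv_im_ne_zero hdf)
      (differentiableOn_deriv_im_ne_zero hdg)).congr fun z hz => ?_⟩
    exact ((differentiableAt_of_im_ne_zero hdf hz).hasDerivAt.add
      (differentiableAt_of_im_ne_zero hdg hz).hasDerivAt).deriv.symm

theorem mul {n : ℕ} {f g : ℂ → ℂ} (hf : NormallyDifferentiable n f)
    (hg : NormallyDifferentiable n g) (hdf : DifferentiableOn ℂ f {z : ℂ | z.im ≠ 0})
    (hdg : DifferentiableOn ℂ g {z : ℂ | z.im ≠ 0}) :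
    NormallyDifferentiable n (fun z => f z * g z) := by
  induction n generalizing f g with
  | zero => trivial
  | succ n ih =>
    obtain ⟨⟨a, b, hab⟩, hf'⟩ := id hf
    obtain ⟨⟨c, d, hcd⟩, hg'⟩ := id hg
    have hdf' := differentiableOn_deriv_im_ne_zero hdf
    have hdg' := differentiableOn_deriv_im_ne_zero hdg
    refine ⟨⟨_, _, hab.mul hcd⟩, ((ih hf' hg.of_succ hdf' hdg).add (ih hf.of_succ hg' hdf hdg')
      (hdf'.mul hdg) (hdf.mul hdg')).congr fun z hz => ?_⟩
    exact ((differentiableAt_of_im_ne_zero hdf hz).hasDerivAt.mul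
      (differentiableAt_of_im_ne_zero hdg hz).hasDerivAt).deriv.symm

theorem polynomial_eval (n : ℕ) (p : Polynomial ℂ) :
    NormallyDifferentiable n (fun z => p.eval z) := by
  induction n generalizing p with
  | zero => trivial
  | succ n ih =>
    refine ⟨⟨_, _, .of_hasDerivAt (p.hasDerivAt 0)⟩, (ih p.derivative).congr fun z _ => ?_⟩
    exact p.deriv.symm

theorem const (n : ℕ) (c : ℂ) : NormallyDifferentiable n (fun _ => c) := by
  simpa using polynomial_eval n (.C c)

theorem inv {n : ℕ} {f : ℂ → ℂ} {a : ℂ} (hf : NormallyDifferentiable n f)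
    (hdf : DifferentiableOn ℂ f {z : ℂ | z.im ≠ 0})
    (hlim : Tendsto (fun y : ℝ => f (y * I)) (𝓝[≠] 0) (𝓝 a)) (ha : a ≠ 0)
    (h0 : ∀ z : ℂ, z.im ≠ 0 → f z ≠ 0) : NormallyDifferentiable n (fun z => (f z)⁻¹) := by
  induction n with
  | zero => trivial
  | succ n ih =>
    obtain ⟨⟨a', b, hab⟩, hf'⟩ := id hf
    obtain rfl := tendsto_nhds_unique hab.1 hlim
    have hdi : DifferentiableOn ℂ (fun z => (f z)⁻¹) {z : ℂ | z.im ≠ 0} := hdf.inv h0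
    have ih' := ih hf.of_succ
    have hdf' := differentiableOn_deriv_im_ne_zero hdf
    refine ⟨⟨_, _, hab.inv ha h0⟩, (((const n (-1)).mul hf' (by fun_prop) hdf').mul
      (ih'.mul ih' hdi hdi) (hdf'.const_mul _) (hdi.mul hdi)).congr fun z hz => ?_⟩
    have := ((differentiableAt_of_im_ne_zero hdf hz).hasDerivAt.inv (h0 z hz)).deriv
    rw [show (fun z => (f z)⁻¹) = f⁻¹ from rfl, this]
    have := h0 z hz
    field_simp

theorem sum {α : Type*} {n : ℕ} (s : Finset α) {f : α → ℂ → ℂ}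
    (hf : ∀ i ∈ s, NormallyDifferentiable n (f i))
    (hdf : ∀ i ∈ s, DifferentiableOn ℂ (f i) {z : ℂ | z.im ≠ 0}) :
    NormallyDifferentiable n (fun z => ∑ i ∈ s, f i z) := by
  classical
  induction s using Finset.induction_on with
  | empty => simpa using const n 0
  | insert i s hi ih =>
    simp only [Finset.sum_insert hi]
    have hs := fun j hj => hdf j (Finset.mem_insert_of_mem hj)
    exact (hf i (Finset.mem_insert_self _ _)).add
      (ih (fun j hj => hf j (Finset.mem_insert_of_mem hj)) hs)
      (hdf i (Finset.mem_insert_self _ _)) (DifferentiableOn.fun_sum hs)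

theorem prod {α : Type*} {n : ℕ} (s : Finset α) {f : α → ℂ → ℂ}
    (hf : ∀ i ∈ s, NormallyDifferentiable n (f i))
    (hdf : ∀ i ∈ s, DifferentiableOn ℂ (f i) {z : ℂ | z.im ≠ 0}) :
    NormallyDifferentiable n (fun z => ∏ i ∈ s, f i z) := by
  classical
  induction s using Finset.induction_on with
  | empty => simpa using const n 1
  | insert i s hi ih =>
    simp only [Finset.prod_insert hi]
    have hs := fun j hj => hdf j (Finset.mem_insert_of_mem hj)
    exact (hf i (Finset.mem_insert_self _ _)).mul
      (ih (fun j hj => hf j (Finset.mem_insert_of_mem hj)) hs)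
      (hdf i (Finset.mem_insert_self _ _)) (DifferentiableOn.fun_finsetProd hs)

theorem iff_forall_lt {n : ℕ} {f : ℂ → ℂ} :
    NormallyDifferentiable n f ↔ ∀ k < n, ∃ a b, HasNormalExpansion (deriv^[k] f) a b := by
  induction n generalizing f with
  | zero => simp [NormallyDifferentiable]
  | succ n ih =>
    rw [NormallyDifferentiable, ih]
    constructor
    · rintro ⟨h0, h1⟩ (_ | k) hk
      · exact h0
      · exact h1 k (by lia)
    · intro h
      exact ⟨h 0 (by lia), fun k hk => h (k + 1) (by lia)⟩

end NormallyDifferentiable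

namespace NormallyFlat

theorem congr {n : ℕ} {f g : ℂ → ℂ} (hf : NormallyFlat n f)
    (h : Set.EqOn f g {z : ℂ | z.im ≠ 0}) : NormallyFlat n g := by
  induction n generalizing f g with
  | zero => trivial
  | succ n ih =>
    exact ⟨hf.1.congr' (tendsto_congr_im_ne_zero h) .rfl, ih hf.2 (deriv_eqOn_im_ne_zero h)⟩

theorem add {n : ℕ} {f g : ℂ → ℂ} (hf : NormallyFlat n f)
    (hg : NormallyFlat n g) (hdf : DifferentiableOn ℂ f {z : ℂ | z.im ≠ 0})
    (hdg : DifferentiableOn ℂ g {z : ℂ | z.im ≠ 0}) :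
    NormallyFlat n (fun z => f z + g z) := by
  induction n generalizing f g with
  | zero => trivial
  | succ n ih =>
    refine ⟨hf.1.add hg.1, (ih hf.2 hg.2 (differentiableOn_deriv_im_ne_zero hdf)
      (differentiableOn_deriv_im_ne_zero hdg)).congr fun z hz => ?_⟩
    exact ((differentiableAt_of_im_ne_zero hdf hz).hasDerivAt.add
      (differentiableAt_of_im_ne_zero hdg hz).hasDerivAt).deriv.symm

theorem const_mul {n : ℕ} {f : ℂ → ℂ} (c : ℂ) (hf : NormallyFlat n f)
    (hdf : DifferentiableOn ℂ f {z : ℂ | z.im ≠ 0}) : NormallyFlat n (fun z => c * f z) := by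
  induction n generalizing f with
  | zero => trivial
  | succ n ih =>
    refine ⟨hf.1.const_mul_left c,
      (ih hf.2 (differentiableOn_deriv_im_ne_zero hdf)).congr fun z hz => ?_⟩
    exact ((differentiableAt_of_im_ne_zero hdf hz).hasDerivAt.const_mul c).deriv.symm

/-- Since `(f / z^m)' = f' / z^m - m f / z^(m+1)`, the exponent `m` has to vary in the induction on
`n`. -/
theorem div_pow {n m : ℕ} {f : ℂ → ℂ} (hf : NormallyFlat (n + m) f)
    (hdf : DifferentiableOn ℂ f {z : ℂ | z.im ≠ 0}) : NormallyFlat n (fun z => f z / z ^ m) := by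
  have hz0 : ∀ z : ℂ, z.im ≠ 0 → z ≠ 0 := fun z hz h0 => hz (by simp [h0])
  have hdp : ∀ (g : ℂ → ℂ) (k : ℕ), DifferentiableOn ℂ g {z : ℂ | z.im ≠ 0} →
      DifferentiableOn ℂ (fun z => g z / z ^ k) {z : ℂ | z.im ≠ 0} := fun g k hg =>
    hg.div (by fun_prop) fun z hz => pow_ne_zero k (hz0 z hz)
  induction n generalizing f m with
  | zero => trivial
  | succ n ih =>
    have hdf' := differentiableOn_deriv_im_ne_zero hdf
    have h1 := ih (m := m + 1) (f := f) (by rwa [← add_assoc, add_right_comm]) hdf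
    rw [add_right_comm] at hf
    refine ⟨?_, ((ih hf.2 hdf').add (h1.const_mul (-m) (hdp f _ hdf)) (hdp _ m hdf')
      ((hdp f _ hdf).const_mul _)).congr fun z hz => ?_⟩
    · have h2 : (fun y : ℝ => ((y * I : ℂ) ^ m)⁻¹) =O[𝓝[≠] 0] (fun y : ℝ => (y ^ m)⁻¹) :=
        Asymptotics.IsBigO.of_bound 1 (Eventually.of_forall fun y => by simp)
      refine (hf.1.mul_isBigO h2).congr' (Eventually.of_forall fun y => (div_eq_mul_inv _ _).symm) ?_
      filter_upwards [self_mem_nhdsWithin] with y hy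
      have : y ≠ 0 := hy
      field_simp
      ring
    · have := hz0 z hz
      have h3 := ((differentiableAt_of_im_ne_zero hdf hz).hasDerivAt.div (hasDerivAt_pow m z)
        (pow_ne_zero m this)).deriv
      refine Eq.trans ?_ h3.symm
      -- The derivative of `z ^ m` involves the truncated exponent `m - 1`, hence the separate case
      -- `m = 0`.
      rcases m with _ | m
      · simp
      · field_simp
        simp
        ring

theorem tendsto {n : ℕ} {f : ℂ → ℂ} (hf : NormallyFlat (n + 1) f) :
    Tendsto (fun y : ℝ => f (y * I)) (𝓝[≠] 0) (𝓝 0) := by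
  refine hf.1.trans_tendsto ?_
  have : Continuous fun y : ℝ => y ^ (n + 1) := by fun_prop
  simpa using (this.tendsto 0).mono_left nhdsWithin_le_nhds

theorem normallyDifferentiable {n : ℕ} {f : ℂ → ℂ} (hf : NormallyFlat n f) :
    NormallyDifferentiable n f := by
  induction n generalizing f with
  | zero => trivial
  | succ n ih =>
    refine ⟨⟨0, 0, .of_tendsto ?_⟩, ih hf.2⟩
    have h1 : (fun y : ℝ => y ^ (n + 1)) =O[𝓝[≠] 0] (fun y : ℝ => (y * I : ℂ)) := by
      refine Asymptotics.IsBigO.of_bound 1 ?_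
      filter_upwards [mem_nhdsWithin_of_mem_nhds (Metric.ball_mem_nhds 0 one_pos)] with y hy
      have : |y| ≤ 1 := le_of_lt (by simpa using hy)
      simpa using pow_le_of_le_one (abs_nonneg y) this (Nat.succ_ne_zero n)
    refine (hf.1.trans_isBigO h1).tendsto_div_nhds_zero.congr fun y => ?_
    rw [sub_zero, div_eq_inv_mul]

end NormallyFlat

theorem Polynomial.exists_derivative_eq (q : Polynomial ℂ) :
    ∃ p : Polynomial ℂ, p.derivative = q := by
  induction q using Polynomial.induction_on' with
  | add p q hp hq =>
    obtain ⟨P, rfl⟩ := hp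
    obtain ⟨Q, rfl⟩ := hq
    exact ⟨P + Q, Polynomial.derivative_add⟩
  | monomial n a =>
    refine ⟨Polynomial.monomial (n + 1) (a / (n + 1)), ?_⟩
    rw [Polynomial.derivative_monomial]
    have : (n + 1 : ℂ) ≠ 0 := Nat.cast_add_one_ne_zero n
    simp [this]

namespace NormallyDifferentiable

/-- Taylor's formula along the normal. -/
theorem exists_polynomial {n : ℕ} {f : ℂ → ℂ} (hf : NormallyDifferentiable (n + 1) f)
    (hdf : DifferentiableOn ℂ f {z : ℂ | z.im ≠ 0}) :
    ∃ p : Polynomial ℂ, NormallyFlat (n + 1) (fun z => f z - p.eval z) := by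
  have hpoly : ∀ p : Polynomial ℂ,
      Tendsto (fun y : ℝ => p.eval (y * I : ℂ)) (𝓝[≠] 0) (𝓝 (p.eval 0)) := fun p =>
    (p.continuous.tendsto 0).comp tendsto_ofReal_mul_I
  induction n generalizing f with
  | zero =>
    obtain ⟨⟨a, b, hab⟩, -⟩ := hf
    refine ⟨.C a + .C b * .X, ?_, trivial⟩
    have h1 := hab.2.sub_const b
    rw [sub_self] at h1
    rw [← Asymptotics.isLittleO_one_iff ℝ] at h1
    have h2 : (fun y : ℝ => (y * I : ℂ)) =O[𝓝[≠] 0] (fun y : ℝ => y ^ (0 + 1)) :=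
      Asymptotics.IsBigO.of_bound 1 (Eventually.of_forall fun y => by simp)
    refine (h2.mul_isLittleO h1).congr' ?_ (Eventually.of_forall fun y => mul_one _)
    filter_upwards [self_mem_nhdsWithin] with y hy
    have : (y : ℂ) ≠ 0 := by simpa using hy
    have := I_ne_zero
    have e : (y * I : ℂ) * (y * I)⁻¹ = 1 := mul_inv_cancel₀ (by positivity)
    simp only [Polynomial.eval_add, Polynomial.eval_mul, Polynomial.eval_C, Polynomial.eval_X]
    linear_combination (f (y * I) - a) * e
  | succ n ih =>
    obtain ⟨⟨a, b, hab⟩, hf'⟩ := hf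
    obtain ⟨q, hq⟩ := ih hf' (differentiableOn_deriv_im_ne_zero hdf)
    -- Integrate the Taylor polynomial of `f'`. The constant `a - p(0)` makes the remainder tend to
    -- `0`, so its size follows from that of its derivative.
    obtain ⟨p, rfl⟩ := q.exists_derivative_eq
    have hd : DifferentiableOn ℂ (fun z => f z - (p + .C (a - p.eval 0)).eval z)
        {z : ℂ | z.im ≠ 0} := hdf.sub (Polynomial.differentiable _).differentiableOn
    have h1 : NormallyFlat (n + 1) (deriv fun z => f z - (p + .C (a - p.eval 0)).eval z) := by
      refine hq.congr fun z hz => ?_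
      have := ((differentiableAt_of_im_ne_zero hdf hz).hasDerivAt.sub
        ((p + .C (a - p.eval 0)).hasDerivAt z)).deriv
      refine Eq.trans ?_ this.symm
      simp
    refine ⟨_, isLittleO_normal_of_deriv hd ?_ h1.1, h1⟩
    have := hab.1.sub (hpoly (p + .C (a - p.eval 0)))
    simpa using this

/-- Division by the independent variable lowers the order by one. -/
theorem div_id {n : ℕ} {f : ℂ → ℂ} (hf : NormallyDifferentiable (n + 1) f)
    (hdf : DifferentiableOn ℂ f {z : ℂ | z.im ≠ 0})
    (h0 : Tendsto (fun y : ℝ => f (y * I)) (𝓝[≠] 0) (𝓝 0)) :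
    NormallyDifferentiable n (fun z => f z / z) := by
  obtain ⟨p, hp⟩ := hf.exists_polynomial hdf
  have hdp : DifferentiableOn ℂ (fun z => p.eval z) {z : ℂ | z.im ≠ 0} :=
    p.differentiable.differentiableOn
  have hz0 : ∀ z : ℂ, z.im ≠ 0 → z ≠ 0 := fun z hz h0 => hz (by simp [h0])
  -- As `f → 0`, the Taylor polynomial has no constant term. Thus `f / z` is the polynomial `p.divX`
  -- plus a flat remainder divided by `z`.
  have h1 : p.coeff 0 = 0 := by
    have h2 := h0.sub hp.tendsto
    simp only [sub_sub_cancel, sub_zero] at h2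
    rw [Polynomial.coeff_zero_eq_eval_zero]
    exact tendsto_nhds_unique ((p.continuous.tendsto 0).comp tendsto_ofReal_mul_I) h2
  have h2 := (hp.div_pow (m := 1) (hdf.sub hdp)).normallyDifferentiable
  refine ((polynomial_eval n p.divX).add h2 p.divX.differentiable.differentiableOn
    ((hdf.sub hdp).div (by fun_prop) fun z hz => pow_ne_zero 1 (hz0 z hz))).congr fun z hz => ?_
  have h3 := congrArg (Polynomial.eval z) p.divX_mul_X_add
  rw [h1] at h3
  simp at h3
  have := hz0 z hz
  simp only [← h3]
  field_simp
  ring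

end NormallyDifferentiable

/-! ### Normal derivatives as limits, and their link with the expansions. -/

section Normal

set_option linter.unusedSectionVars false

variable {F : Type*} [AddCommGroup F] [Module ℂ F] [TopologicalSpace F]
  [ContinuousSMul ℂ F] [IsTopologicalAddGroup F]

theorem normalQuotient_zero_zero (f : ℂ → F) (d : F) :
    normalQuotient f 0 d 0 = fun y : ℝ => f (y * I) := by
  funext y
  simp [normalQuotient]

theorem normalQuotient_zero_succ (f : ℂ → F) (d : F) (k : ℕ) :
    normalQuotient f 0 d (k + 1) = fun y : ℝ => (y * I : ℂ)⁻¹ • (deriv^[k] f (y * I) - d) := by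
  funext y
  rw [normalQuotient, ofReal_zero, zero_add]

/-- Any sequence of candidates obeying the recursion is the sequence of normal derivatives, by
uniqueness of limits. At `k = 0` the entry `c (0 - 1)` is harmless, as `normalQuotient` ignores it
there. -/
theorem normalDeriv_eq_of_tendsto [T2Space F] {f : ℂ → F} {x : ℝ} {c : ℕ → F} {r : ℕ∞}
    (h : ∀ k : ℕ, (k : ℕ∞) ≤ r →
      Tendsto (normalQuotient f x (c (k - 1)) k) (𝓝[≠] (0 : ℝ)) (𝓝 (c k))) (k : ℕ)
    (hk : (k : ℕ∞) ≤ r) : normalDeriv f x k = c k := by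
  induction k with
  | zero => exact (h 0 hk).limUnder_eq
  | succ k ih =>
    rw [normalDeriv, ih (le_trans (by norm_cast; lia) hk)]
    exact (h (k + 1) hk).limUnder_eq

theorem hasNormalDerivs_of_tendsto [T2Space F] {f : ℂ → F} {x : ℝ} {c : ℕ → F} {r : ℕ∞}
    (h : ∀ k : ℕ, (k : ℕ∞) ≤ r →
      Tendsto (normalQuotient f x (c (k - 1)) k) (𝓝[≠] (0 : ℝ)) (𝓝 (c k))) :
    HasNormalDerivs f x r := fun k hk => by
  rw [normalDeriv_eq_of_tendsto h _ (le_trans (by norm_cast; lia) hk)]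
  exact ⟨_, h k hk⟩

theorem HasNormalDerivs.tendsto [T2Space F] {f : ℂ → F} {x : ℝ} {r : ℕ∞} (h : HasNormalDerivs f x r) (k : ℕ)
    (hk : (k : ℕ∞) ≤ r) :
    Tendsto (normalQuotient f x (normalDeriv f x (k - 1)) k) (𝓝[≠] (0 : ℝ))
      (𝓝 (normalDeriv f x k)) := by
  obtain ⟨l, hl⟩ := h k hk
  cases k with
  | zero =>
    rw [show normalDeriv f x 0 = l from hl.limUnder_eq]
    exact hl
  | succ k =>
    rw [show normalDeriv f x (k + 1) = l from hl.limUnder_eq]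
    exact hl

theorem HasNormalDerivs.mono {f : ℂ → F} {x : ℝ} {r s : ℕ∞} (h : HasNormalDerivs f x r)
    (hs : s ≤ r) : HasNormalDerivs f x s := fun k hk => h k (hk.trans hs)

end Normal

theorem HasNormalDerivs.hasNormalExpansion {f : ℂ → ℂ} {r : ℕ∞} (h : HasNormalDerivs f 0 r) {k : ℕ}
    (hk : ((k + 1 : ℕ) : ℕ∞) ≤ r) :
    HasNormalExpansion (deriv^[k] f) (normalDeriv f 0 k) (normalDeriv f 0 (k + 1)) := by
  apply HasNormalExpansion.of_tendsto
  have := h.tendsto (k + 1) hk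
  rwa [normalQuotient_zero_succ] at this

/-- `NormallyDifferentiable 0` is vacuous, so the limit of order zero is listed separately. In the
converse the expansions of successive derivatives fit together because a normal derivative is the
limit of the derivatives (`of_tendsto_deriv`). -/
theorem hasNormalDerivs_iff {f : ℂ → ℂ} {r : ℕ∞} (hdf : DifferentiableOn ℂ f {z : ℂ | z.im ≠ 0}) :
    HasNormalDerivs f 0 r ↔ (∃ a, Tendsto (fun y : ℝ => f (y * I)) (𝓝[≠] 0) (𝓝 a)) ∧
      ∀ n : ℕ, (n : ℕ∞) ≤ r → NormallyDifferentiable n f := by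
  constructor
  · intro h
    refine ⟨⟨_, by simpa only [normalQuotient_zero_zero] using h.tendsto 0 (by simp)⟩, fun n hn => ?_⟩
    rw [NormallyDifferentiable.iff_forall_lt]
    intro k hk
    exact ⟨_, _, h.hasNormalExpansion (le_trans (by norm_cast) hn)⟩
  · rintro ⟨⟨a, ha⟩, h⟩
    have hex : ∀ k : ℕ, ((k + 1 : ℕ) : ℕ∞) ≤ r → ∃ a b, HasNormalExpansion (deriv^[k] f) a b :=
      fun k hk => NormallyDifferentiable.iff_forall_lt.1 (h _ hk) k (by lia)
    choose! u v huv using hex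
    have hmatch : ∀ k : ℕ, ((k + 1 + 1 : ℕ) : ℕ∞) ≤ r → v k = u (k + 1) := by
      intro k hk
      have hk' : ((k + 1 : ℕ) : ℕ∞) ≤ r := le_trans (by norm_cast; lia) hk
      have h1 := (huv (k + 1) hk).1
      rw [Function.iterate_succ_apply'] at h1
      exact ((huv k hk').unique (.of_tendsto_deriv
        (differentiableOn_iterate_deriv_im_ne_zero hdf k) (huv k hk').1 h1)).2
    -- The derivative of order `k + 1` is the slope `v k` of the `k`-th derivative; order zero has
    -- no predecessor and takes the limit `a`.
    apply hasNormalDerivs_of_tendsto (c := fun k => k.casesOn a v)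
    rintro (_ | k) hk
    · rw [normalQuotient_zero_zero]
      exact ha
    · have h1 := (huv k hk).2
      have h2 : u k = k.casesOn (motive := fun _ => ℂ) a v := by
        cases k with
        | zero => exact tendsto_nhds_unique (huv 0 hk).1 ha
        | succ k => exact (hmatch k hk).symm
      rw [h2] at h1
      rwa [normalQuotient_zero_succ]

end

/-! ### Matrix-valued functions, entry by entry. -/

section

open Complex ComplexConjugate

section Entries

attribute [local instance] Matrix.normedAddCommGroup Matrix.normedSpace

variable {ι : Type*} [Fintype ι] {f : ℂ → Matrix ι ι ℂ}

theorem differentiableOn_matrix_iff {s : Set ℂ} :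
    DifferentiableOn ℂ f s ↔ ∀ i j, DifferentiableOn ℂ (fun z => f z i j) s := by
  refine Iff.trans (differentiableOn_pi (𝕜 := ℂ) (Φ := (f : ℂ → ι → ι → ℂ))) ?_
  exact forall_congr' fun i => differentiableOn_pi

theorem deriv_matrix_apply {z : ℂ} (hf : DifferentiableAt ℂ f z) (i j : ι) :
    deriv f z i j = deriv (fun z => f z i j) z := by
  have h := hf.hasDerivAt
  have h1 := hasDerivAt_pi.1 (show HasDerivAt (f : ℂ → ι → ι → ℂ) (deriv f z) z from h) i
  exact (hasDerivAt_pi.1 h1 j).deriv.symm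

theorem differentiableOn_iterate_deriv_matrix (hf : DifferentiableOn ℂ f {z : ℂ | z.im ≠ 0}) (k : ℕ) :
    DifferentiableOn ℂ (deriv^[k] f) {z : ℂ | z.im ≠ 0} := by
  induction k with
  | zero => exact hf
  | succ k ih => rw [Function.iterate_succ_apply']; exact ih.deriv isOpen_im_ne_zero

theorem iterate_deriv_matrix_apply (hf : DifferentiableOn ℂ f {z : ℂ | z.im ≠ 0}) (k : ℕ) (i j : ι)
    {z : ℂ} (hz : z.im ≠ 0) : deriv^[k] f z i j = deriv^[k] (fun z => f z i j) z := by
  induction k generalizing z with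
  | zero => rfl
  | succ k ih =>
    rw [Function.iterate_succ_apply', Function.iterate_succ_apply', deriv_matrix_apply
      ((differentiableOn_iterate_deriv_matrix hf k).differentiableAt
        (isOpen_im_ne_zero.mem_nhds hz))]
    exact deriv_eqOn_im_ne_zero (fun z hz => ih hz) hz

end Entries

variable {ι : Type*} [Fintype ι]

omit [Fintype ι] in
theorem tendsto_matrix_iff {α : Type*} {l : Filter α} {A : α → Matrix ι ι ℂ} {B : Matrix ι ι ℂ} :
    Tendsto A l (𝓝 B) ↔ ∀ i j, Tendsto (fun t => A t i j) l (𝓝 (B i j)) := by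
  refine (tendsto_pi_nhds (f := (A : α → ι → ι → ℂ))).trans ?_
  exact forall_congr' fun i => tendsto_pi_nhds

theorem normalQuotient_matrix_apply {f : ℂ → Matrix ι ι ℂ}
    (hf : DifferentiableOn ℂ f {z : ℂ | z.im ≠ 0}) (d : Matrix ι ι ℂ) (k : ℕ) (i j : ι) {y : ℝ}
    (hy : y ≠ 0) :
    normalQuotient f 0 d k y i j = normalQuotient (fun z => f z i j) 0 (d i j) k y := by
  cases k with
  | zero => rfl
  | succ k =>
    simp only [normalQuotient_zero_succ, Matrix.smul_apply, Matrix.sub_apply]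
    rw [iterate_deriv_matrix_apply hf k i j (by simpa using hy)]

theorem tendsto_normalQuotient_matrix_iff {f : ℂ → Matrix ι ι ℂ}
    (hf : DifferentiableOn ℂ f {z : ℂ | z.im ≠ 0}) (c d : Matrix ι ι ℂ) (k : ℕ) :
    Tendsto (normalQuotient f 0 c k) (𝓝[≠] 0) (𝓝 d) ↔
      ∀ i j, Tendsto (normalQuotient (fun z => f z i j) 0 (c i j) k) (𝓝[≠] 0) (𝓝 (d i j)) := by
  rw [tendsto_matrix_iff]
  refine forall_congr' fun i => forall_congr' fun j => tendsto_congr' ?_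
  filter_upwards [self_mem_nhdsWithin] with y hy using normalQuotient_matrix_apply hf c k i j hy

/-- Normal derivatives of matrix valued functions are taken entrywise. -/
theorem hasNormalDerivs_matrix_iff {f : ℂ → Matrix ι ι ℂ}
    (hf : DifferentiableOn ℂ f {z : ℂ | z.im ≠ 0}) {r : ℕ∞} :
    HasNormalDerivs f 0 r ↔ ∀ i j, HasNormalDerivs (fun z => f z i j) 0 r := by
  constructor
  · intro h i j
    exact hasNormalDerivs_of_tendsto (c := fun k => normalDeriv f 0 k i j) fun k hk =>
      (tendsto_normalQuotient_matrix_iff hf _ _ k).1 (h.tendsto k hk) i j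
  · intro h
    exact hasNormalDerivs_of_tendsto
      (c := fun k => Matrix.of fun i j => normalDeriv (fun z => f z i j) 0 k) fun k hk =>
      (tendsto_normalQuotient_matrix_iff hf _ _ k).2 fun i j => (h i j).tendsto k hk

section Inverse

variable [DecidableEq ι]

theorem Filter.Tendsto.matrix_inv {α : Type*} {l : Filter α} {A : α → Matrix ι ι ℂ}
    {B : Matrix ι ι ℂ} (h : Tendsto A l (𝓝 B)) (hB : IsUnit B) :
    Tendsto (fun t => (A t)⁻¹) l (𝓝 B⁻¹) := by
  have h1 := ((continuous_id.matrix_det).tendsto B).comp h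
  have h2 := ((continuous_id.matrix_adjugate).tendsto B).comp h
  simp only [Matrix.inv_def, Ring.inverse_eq_inv']
  exact (h1.inv₀ ((Matrix.isUnit_iff_isUnit_det B).1 hB).ne_zero).smul h2

variable {A : ℂ → Matrix ι ι ℂ}

theorem differentiableOn_matrix_det
    (hd : ∀ i j, DifferentiableOn ℂ (fun z => A z i j) {z : ℂ | z.im ≠ 0}) :
    DifferentiableOn ℂ (fun z => (A z).det) {z : ℂ | z.im ≠ 0} := by
  simp only [Matrix.det_apply']
  exact .fun_sum fun σ _ => .const_mul (.fun_finsetProd fun i _ => hd _ _) _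

theorem NormallyDifferentiable.matrix_det {n : ℕ}
    (h : ∀ i j, NormallyDifferentiable n (fun z => A z i j))
    (hd : ∀ i j, DifferentiableOn ℂ (fun z => A z i j) {z : ℂ | z.im ≠ 0}) :
    NormallyDifferentiable n (fun z => (A z).det) := by
  simp only [Matrix.det_apply']
  have hp : ∀ σ : Equiv.Perm ι, DifferentiableOn ℂ (fun z => ∏ i, A z (σ i) i)
      {z : ℂ | z.im ≠ 0} := fun σ => .fun_finsetProd fun i _ => hd _ _
  exact .sum _ (fun σ _ => (const n _).mul (.prod _ (fun i _ => h _ _) fun i _ => hd _ _)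
    (by fun_prop) (hp σ)) fun σ _ => (hp σ).const_mul _

theorem differentiableOn_matrix_adjugate
    (hd : ∀ i j, DifferentiableOn ℂ (fun z => A z i j) {z : ℂ | z.im ≠ 0}) (i j : ι) :
    DifferentiableOn ℂ (fun z => (A z).adjugate i j) {z : ℂ | z.im ≠ 0} := by
  simp only [Matrix.adjugate_apply]
  refine differentiableOn_matrix_det fun k l => ?_
  simp only [Matrix.updateRow_apply]
  split_ifs
  · fun_prop
  · exact hd _ _

theorem NormallyDifferentiable.matrix_adjugate {n : ℕ}
    (h : ∀ i j, NormallyDifferentiable n (fun z => A z i j))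
    (hd : ∀ i j, DifferentiableOn ℂ (fun z => A z i j) {z : ℂ | z.im ≠ 0}) (i j : ι) :
    NormallyDifferentiable n (fun z => (A z).adjugate i j) := by
  simp only [Matrix.adjugate_apply]
  refine .matrix_det (fun k l => ?_) fun k l => ?_ <;> simp only [Matrix.updateRow_apply] <;>
    split_ifs
  · exact const n _
  · exact h _ _
  · fun_prop
  · exact hd _ _

/-- Cramer's rule reduces inversion of matrix functions to sums, products and one scalar inverse. -/
theorem matrix_inv_apply (B : Matrix ι ι ℂ) (i j : ι) :
    B⁻¹ i j = B.det⁻¹ * B.adjugate i j := by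
  rw [Matrix.inv_def, Ring.inverse_eq_inv', Matrix.smul_apply, smul_eq_mul]

theorem det_ne_zero_of_isUnit {B : Matrix ι ι ℂ} (h : IsUnit B) : B.det ≠ 0 :=
  ((Matrix.isUnit_iff_isUnit_det B).1 h).ne_zero

theorem differentiableOn_matrix_inv
    (hd : ∀ i j, DifferentiableOn ℂ (fun z => A z i j) {z : ℂ | z.im ≠ 0})
    (hu : ∀ z : ℂ, z.im ≠ 0 → IsUnit (A z)) (i j : ι) :
    DifferentiableOn ℂ (fun z => (A z)⁻¹ i j) {z : ℂ | z.im ≠ 0} := by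
  simp only [matrix_inv_apply]
  exact ((differentiableOn_matrix_det hd).inv fun z hz => det_ne_zero_of_isUnit (hu z hz)).mul
    (differentiableOn_matrix_adjugate hd i j)

theorem NormallyDifferentiable.matrix_inv {n : ℕ} {B : Matrix ι ι ℂ}
    (h : ∀ i j, NormallyDifferentiable n (fun z => A z i j))
    (hd : ∀ i j, DifferentiableOn ℂ (fun z => A z i j) {z : ℂ | z.im ≠ 0})
    (hu : ∀ z : ℂ, z.im ≠ 0 → IsUnit (A z))
    (hlim : Tendsto (fun y : ℝ => A (y * I)) (𝓝[≠] 0) (𝓝 B)) (hB : IsUnit B) (i j : ι) :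
    NormallyDifferentiable n (fun z => (A z)⁻¹ i j) := by
  simp only [matrix_inv_apply]
  have h0 : ∀ z : ℂ, z.im ≠ 0 → (A z).det ≠ 0 := fun z hz => det_ne_zero_of_isUnit (hu z hz)
  have hdet := differentiableOn_matrix_det hd
  exact ((NormallyDifferentiable.matrix_det h hd).inv hdet
    (((continuous_id.matrix_det).tendsto B).comp hlim) (det_ne_zero_of_isUnit hB) h0).mul
    (.matrix_adjugate h hd i j) (hdet.inv h0) (differentiableOn_matrix_adjugate hd i j)

end Inverse

end

/-! ### Matrix Nevanlinna functions through their quadratic forms. -/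

section

open Complex ComplexConjugate

open Matrix

variable {ι : Type*} [Fintype ι]

theorem star_dotProduct_mulVec_conjTranspose (A : Matrix ι ι ℂ) (v w : ι → ℂ) :
    star v ⬝ᵥ Aᴴ *ᵥ w = conj (star w ⬝ᵥ A *ᵥ v) := by
  rw [starRingEnd_apply, star_dotProduct, star_mulVec, conjTranspose_conjTranspose,
    ← dotProduct_mulVec]

theorem star_dotProduct_imaginaryPart_mulVec (A : Matrix ι ι ℂ) (v : ι → ℂ) :
    star v ⬝ᵥ (imaginaryPart A : Matrix ι ι ℂ) *ᵥ v = ((star v ⬝ᵥ A *ᵥ v).im : ℂ) := by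
  have h : ∀ x : ℂ, (x.im : ℂ) = -I * ((2⁻¹ : ℝ) * (x - conj x)) := by
    intro x
    rw [sub_conj]
    push_cast
    linear_combination (x.im : ℂ) * I_sq
  rw [h, ← star_dotProduct_mulVec_conjTranspose, imaginaryPart_apply_coe]
  simp only [neg_smul, neg_mulVec, smul_mulVec, sub_mulVec, dotProduct_neg, dotProduct_smul,
    dotProduct_sub, star_eq_conjTranspose, real_smul, smul_eq_mul, neg_mul]

omit [Fintype ι] in
theorem isHermitian_imaginaryPart (A : Matrix ι ι ℂ) :
    (imaginaryPart A : Matrix ι ι ℂ).IsHermitian := (imaginaryPart A).2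

theorem posSemidef_smul_imaginaryPart_iff (A : Matrix ι ι ℂ) (c : ℝ) :
    (c • (imaginaryPart A : Matrix ι ι ℂ)).PosSemidef ↔
      ∀ v : ι → ℂ, 0 ≤ c * (star v ⬝ᵥ A *ᵥ v).im := by
  have key : ∀ v : ι → ℂ, star v ⬝ᵥ (c • (imaginaryPart A : Matrix ι ι ℂ)) *ᵥ v =
      ((c * (star v ⬝ᵥ A *ᵥ v).im : ℝ) : ℂ) := fun v => by
    rw [smul_mulVec, dotProduct_smul, star_dotProduct_imaginaryPart_mulVec, real_smul, ofReal_mul]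
  have hH : (c • (imaginaryPart A : Matrix ι ι ℂ)).IsHermitian := by
    rw [IsHermitian, conjTranspose_smul, (isHermitian_imaginaryPart A).eq, star_trivial]
  rw [posSemidef_iff_dotProduct_mulVec]
  simp only [key]
  refine ⟨fun h v => by exact_mod_cast h.2 v, fun h => ⟨hH, fun v => by exact_mod_cast h v⟩⟩

theorem differentiableOn_quadratic {f : ℂ → Matrix ι ι ℂ} {s : Set ℂ} (hf : DifferentiableOn ℂ f s)
    (v w : ι → ℂ) : DifferentiableOn ℂ (fun z => v ⬝ᵥ f z *ᵥ w) s := by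
  have h := differentiableOn_matrix_iff.1 hf
  simp only [dotProduct, mulVec]
  exact .fun_sum fun i _ => .const_mul (.fun_sum fun j _ => (h i j).mul_const _) _

namespace IsNevanlinna

variable {f : ℂ → Matrix ι ι ℂ}

/-- This transfers the scalar results of Harnack and Julia to matrices. -/
theorem quadratic (hf : IsNevanlinna f) (v : ι → ℂ) :
    IsScalarNevanlinna (fun z => star v ⬝ᵥ f z *ᵥ v) where
  analytic := differentiableOn_quadratic hf.analytic _ _
  symm z hz := by rw [← star_dotProduct_mulVec_conjTranspose, hf.symm z hz]
  nonneg z hz := by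
    have := (posSemidef_smul_imaginaryPart_iff _ _).1 (hf.nonneg z hz) v
    rwa [div_eq_inv_mul]

theorem of_quadratic (hd : DifferentiableOn ℂ f {z : ℂ | z.im ≠ 0})
    (hs : ∀ z : ℂ, z.im ≠ 0 → (f z)ᴴ = f (conj z))
    (h : ∀ z : ℂ, z.im ≠ 0 → ∀ v : ι → ℂ, 0 ≤ (star v ⬝ᵥ f z *ᵥ v).im / z.im) :
    IsNevanlinna f where
  analytic := hd
  symm := hs
  nonneg z hz := (posSemidef_smul_imaginaryPart_iff _ _).2 fun v => by
    have := h z hz v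
    rwa [div_eq_inv_mul] at this

/-- For a semidefinite matrix the isotropic vectors are exactly the kernel. -/
theorem imaginaryPart_mulVec_eq_zero_iff (hf : IsNevanlinna f) {z : ℂ} (hz : z.im ≠ 0)
    (v : ι → ℂ) :
    (imaginaryPart (f z) : Matrix ι ι ℂ) *ᵥ v = 0 ↔ (star v ⬝ᵥ f z *ᵥ v).im = 0 := by
  have h1 := (hf.nonneg z hz).dotProduct_mulVec_zero_iff v
  rw [smul_mulVec, dotProduct_smul, star_dotProduct_imaginaryPart_mulVec,
    smul_eq_zero_iff_right (inv_ne_zero hz), smul_eq_zero_iff_right (inv_ne_zero hz)] at h1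
  rw [← h1, ofReal_eq_zero]

/-- The form `v* f v` is constant and real once its imaginary part vanishes at one point, so the
kernel does not depend on the point. -/
theorem imaginaryPart_mulVec_eq_zero_of (hf : IsNevanlinna f) {z w : ℂ} (hw : w.im ≠ 0)
    (hz : z.im ≠ 0) {v : ι → ℂ} (h : (imaginaryPart (f w) : Matrix ι ι ℂ) *ᵥ v = 0) :
    (imaginaryPart (f z) : Matrix ι ι ℂ) *ᵥ v = 0 := by
  rw [hf.imaginaryPart_mulVec_eq_zero_iff hw] at h
  rw [hf.imaginaryPart_mulVec_eq_zero_iff hz]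
  obtain ⟨c, hc⟩ := (hf.quadratic v).exists_eq_const hw h
  rw [hc z hz, ofReal_im]

theorem not_isDegenerate_iff (hf : IsNevanlinna f) : ¬ IsDegenerate f ↔ IsNondegenerate f := by
  constructor
  · intro h w hw v hv
    by_contra h0
    exact h fun z hz => ⟨v, h0, hf.imaginaryPart_mulVec_eq_zero_of hw hz hv⟩
  · intro h h1
    obtain ⟨v, hv0, hv⟩ := h1 I (by simp)
    exact hv0 (h I (by simp) v hv)

/-- The kernel of the imaginary part reduces a Nevanlinna function to a constant. -/
theorem mulVec_eq_of_tendsto (hf : IsNevanlinna f) {b : Matrix ι ι ℂ}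
    (hb : Tendsto (fun y : ℝ => f (y * I)) (𝓝[≠] 0) (𝓝 b)) {w : ℂ} (hw : w.im ≠ 0) {v : ι → ℂ}
    (hv : (imaginaryPart (f w) : Matrix ι ι ℂ) *ᵥ v = 0) {z : ℂ} (hz : z.im ≠ 0) :
    f z *ᵥ v = b *ᵥ v := by
  have h1 : ∀ z : ℂ, z.im ≠ 0 → (f z)ᴴ *ᵥ v = f z *ᵥ v := by
    intro z hz
    have h2 := hf.imaginaryPart_mulVec_eq_zero_of hw hz hv
    rw [imaginaryPart_apply_coe, smul_mulVec, smul_mulVec, smul_eq_zero_iff_right (by simp),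
      smul_eq_zero_iff_right (by simp), sub_mulVec, sub_eq_zero] at h2
    exact h2.symm
  classical
  -- By `h1`, `u ⬝ᵥ f z *ᵥ v` and `star v ⬝ᵥ f z *ᵥ star u` are analytic and conjugate to each
  -- other. Their sum is real, hence constant; so the first has constant real part and is itself
  -- constant.
  have hconst : ∀ u : ι → ℂ, ∃ c : ℂ, ∀ z : ℂ, 0 < z.im → u ⬝ᵥ f z *ᵥ v = c := by
    intro u
    have hopen : IsOpen {z : ℂ | 0 < z.im} := isOpen_lt continuous_const continuous_im
    have hconn : IsConnected {z : ℂ | 0 < z.im} :=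
      ⟨⟨I, by simp⟩, (convex_halfSpace_im_gt 0).isPreconnected⟩
    have hsub : {z : ℂ | 0 < z.im} ⊆ {z : ℂ | z.im ≠ 0} := fun z hz => ne_of_gt hz
    have hd := (differentiableOn_quadratic hf.analytic u v).mono hsub
    have hd' := (differentiableOn_quadratic hf.analytic (star v) (star u)).mono hsub
    have hk : ∀ z : ℂ, 0 < z.im → star v ⬝ᵥ f z *ᵥ star u = conj (u ⬝ᵥ f z *ᵥ v) := by
      intro z hz
      have := star_dotProduct_mulVec_conjTranspose (f z)ᴴ v (star u)
      rwa [conjTranspose_conjTranspose, star_star, h1 z hz.ne'] at this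
    obtain ⟨c, hc⟩ := AnalyticOnNhd.eq_const_add_im_mul_I_of_re_eq_const (c₀ := 0)
      ((hd.add hd').analyticOnNhd hopen) (fun z hz => by simp [hk z hz]) hopen hconn
    obtain ⟨c', hc'⟩ := AnalyticOnNhd.eq_const_of_re_eq_const (c₀ := c / 2)
      (hd.analyticOnNhd hopen) (fun z hz => by
        have := congrArg Complex.re (hc z hz)
        simp [hk z hz] at this
        linarith) hopen hconn
    exact ⟨c', hc'⟩
  have hupper : ∀ z : ℂ, 0 < z.im → f z *ᵥ v = b *ᵥ v := by
    intro z hz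
    ext i
    obtain ⟨c, hc⟩ := hconst (Pi.single i 1)
    have h2 : Tendsto (fun y : ℝ => Pi.single i 1 ⬝ᵥ f (y * I) *ᵥ v) (𝓝[>] 0)
        (𝓝 (Pi.single i 1 ⬝ᵥ b *ᵥ v)) := by
      have hcont : Continuous fun A : Matrix ι ι ℂ => Pi.single i 1 ⬝ᵥ A *ᵥ v := by fun_prop
      exact (hcont.tendsto b).comp (hb.mono_left (nhdsWithin_mono _ fun y hy => ne_of_gt hy))
    have h3 : Pi.single i 1 ⬝ᵥ b *ᵥ v = c := by
      refine tendsto_nhds_unique h2 (tendsto_const_nhds.congr' ?_)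
      filter_upwards [self_mem_nhdsWithin] with y hy
      exact (hc _ (by simpa using hy)).symm
    rw [← hc z hz] at h3
    simpa using h3.symm
  rcases hz.lt_or_gt with h2 | h2
  · rw [← h1 z hz, hf.symm z hz]
    exact hupper _ (by simpa using h2)
  · exact hupper z h2

/-- The limit is two-sided and `f(iy)† = f(-iy)`. -/
theorem isHermitian_of_tendsto (hf : IsNevanlinna f) {b : Matrix ι ι ℂ}
    (hb : Tendsto (fun y : ℝ => f (y * I)) (𝓝[≠] 0) (𝓝 b)) : b.IsHermitian := by
  have h1 : Tendsto (fun y : ℝ => f ((-y : ℝ) * I)) (𝓝[≠] 0) (𝓝 b) :=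
    hb.comp tendsto_neg_nhdsNE_zero
  have hc : Continuous fun A : Matrix ι ι ℂ => Aᴴ := by fun_prop
  have h2 := (hc.tendsto b).comp hb
  refine tendsto_nhds_unique (h2.congr' ?_) h1
  filter_upwards [eventually_ofReal_mul_I_im_ne_zero] with y hy
  have := hf.symm (y * I) hy
  simpa using this

theorem isHermitian_of_tendsto_smul (hf : IsNevanlinna f) {b d : Matrix ι ι ℂ} (hb : b.IsHermitian)
    (hd : Tendsto (fun y : ℝ => (y * I : ℂ)⁻¹ • (f (y * I) - b)) (𝓝[≠] 0) (𝓝 d)) :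
    d.IsHermitian := by
  have h1 := hd.comp tendsto_neg_nhdsNE_zero
  have hc : Continuous fun A : Matrix ι ι ℂ => Aᴴ := by fun_prop
  have h2 := (hc.tendsto d).comp hd
  refine tendsto_nhds_unique (h2.congr' ?_) h1
  filter_upwards [eventually_ofReal_mul_I_im_ne_zero] with y hy
  have := hf.symm (y * I) hy
  simp only [Function.comp_apply, conjTranspose_smul, conjTranspose_sub, this, hb.eq]
  simp

/-- Harnack gives `v* d v ≥ Im (v* f(i) v)`, which is positive for `v ≠ 0` by non-degeneracy. -/
theorem posDef_of_tendsto (hf : IsNevanlinna f) (hn : IsNondegenerate f) {b d : Matrix ι ι ℂ}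
    (hb : b.IsHermitian)
    (hd : Tendsto (fun y : ℝ => (y * I : ℂ)⁻¹ • (f (y * I) - b)) (𝓝[≠] 0) (𝓝 d)) :
    d.PosDef := by
  have hdH := hf.isHermitian_of_tendsto_smul hb hd
  refine .of_dotProduct_mulVec_pos hdH fun v hv => ?_
  have him : ∀ A : Matrix ι ι ℂ, A.IsHermitian → (star v ⬝ᵥ A *ᵥ v).im = 0 := fun A hA => by
    rw [← conj_eq_iff_im, ← star_dotProduct_mulVec_conjTranspose, hA.eq]
  have hc : Continuous fun A : Matrix ι ι ℂ => star v ⬝ᵥ A *ᵥ v := by fun_prop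
  have h1 := (hf.quadratic v).im_I_le_of_tendsto (him b hb)
    (((hc.tendsto d).comp hd).congr fun y => by
      simp only [Function.comp_apply]
      rw [smul_mulVec, dotProduct_smul, sub_mulVec,
        dotProduct_sub, smul_eq_mul])
  have h2 : 0 < (star v ⬝ᵥ f I *ᵥ v).im := by
    refine lt_of_le_of_ne ((hf.quadratic v).im_nonneg (by simp)) fun h0 => hv ?_
    exact hn I (by simp) v ((hf.imaginaryPart_mulVec_eq_zero_iff (by simp) v).2 h0.symm)
  rw [pos_iff]
  exact ⟨h2.trans_le h1, (him d hdH).symm⟩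

/-- If `f(z) v = b v`, then `v* f(z) v` is real, which puts `v` in the trivial kernel of `Im f(z)`.
-/
theorem isUnit_sub [DecidableEq ι] (hf : IsNevanlinna f) (hn : IsNondegenerate f)
    {b : Matrix ι ι ℂ} (hb : b.IsHermitian) {z : ℂ} (hz : z.im ≠ 0) : IsUnit (f z - b) := by
  rw [← mulVec_injective_iff_isUnit, ← coe_mulVecLin, ← LinearMap.ker_eq_bot, LinearMap.ker_eq_bot']
  intro v hv
  rw [mulVecLin_apply, sub_mulVec, sub_eq_zero] at hv
  apply hn z hz v
  rw [hf.imaginaryPart_mulVec_eq_zero_iff hz, hv, ← conj_eq_iff_im,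
    ← star_dotProduct_mulVec_conjTranspose, hb.eq]

theorem neg_inv_sub [DecidableEq ι] (hf : IsNevanlinna f) {b : Matrix ι ι ℂ} (hb : b.IsHermitian)
    (hu : ∀ z : ℂ, z.im ≠ 0 → IsUnit (f z - b)) : IsNevanlinna (fun z => -(f z - b)⁻¹) := by
  refine .of_quadratic ?_ ?_ ?_
  · refine (differentiableOn_matrix_iff.2 fun i j => ?_)
    have h := differentiableOn_matrix_iff.1 hf.analytic
    exact (differentiableOn_matrix_inv (A := fun z => f z - b) (fun i j => (h i j).sub_const _)
      hu i j).neg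
  · intro z hz
    rw [conjTranspose_neg, conjTranspose_nonsing_inv, conjTranspose_sub, hf.symm z hz, hb.eq]
  · intro z hz w
    have hdet := (isUnit_iff_isUnit_det _).1 (hu z hz)
    -- Substituting `w = (f(z) - b) u` turns the form of `-(f(z) - b)⁻¹` at `w` into minus the
    -- conjugate of the form of `f(z) - b` at `u`.
    set u := (f z - b)⁻¹ *ᵥ w with hu'
    have hw : w = (f z - b) *ᵥ u := by rw [hu', mulVec_mulVec, mul_nonsing_inv _ hdet, one_mulVec]
    have h1 : star w ⬝ᵥ u = conj (star u ⬝ᵥ (f z - b) *ᵥ u) := by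
      rw [← hw, starRingEnd_apply, star_dotProduct]
    have h2 : (star u ⬝ᵥ b *ᵥ u).im = 0 := by
      rw [← conj_eq_iff_im, ← star_dotProduct_mulVec_conjTranspose, hb.eq]
    rw [neg_mulVec, dotProduct_neg, ← hu', h1, sub_mulVec, dotProduct_sub]
    simpa [h2] using (hf.quadratic u).nonneg z hz

end IsNevanlinna

end

/-! ### The Schur transformation of matrix functions. -/

section

open Complex ComplexConjugate

open Matrix

variable {ι : Type*} [Fintype ι] [DecidableEq ι]

/-- The right side is a normal form shared with `schur_expression'_eq`, whence the equality of the
two expressions for the transform. -/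
theorem schur_expression_eq {A s d : Matrix ι ι ℂ} (hA : IsUnit A) (hs : IsUnit s) (hd : s * s = d)
    {z : ℂ} : z⁻¹ • (s⁻¹ * (A - z • d) * A⁻¹ * s) = z⁻¹ • (1 - z • (s * A⁻¹ * s)) := by
  rw [isUnit_iff_isUnit_det] at hA hs
  congr 1
  rw [mul_sub, sub_mul, sub_mul, mul_assoc s⁻¹ A, mul_nonsing_inv _ hA, mul_one,
    nonsing_inv_mul _ hs, ← hd, Matrix.mul_smul, Matrix.smul_mul, Matrix.smul_mul, ← mul_assoc s⁻¹ s,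
    nonsing_inv_mul _ hs, one_mul]

theorem schur_expression'_eq {A s d : Matrix ι ι ℂ} (hA : IsUnit A) (hs : IsUnit s) (hd : s * s = d)
    {z : ℂ} : z⁻¹ • (s * A⁻¹ * (A - z • d) * s⁻¹) = z⁻¹ • (1 - z • (s * A⁻¹ * s)) := by
  rw [isUnit_iff_isUnit_det] at hA hs
  congr 1
  rw [mul_sub, sub_mul, mul_assoc s A⁻¹, nonsing_inv_mul _ hA, mul_one,
    mul_nonsing_inv _ hs, ← hd, Matrix.mul_smul, Matrix.smul_mul, mul_assoc _ (s * s), mul_assoc s s,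
    mul_nonsing_inv _ hs, mul_one]

theorem inv_smul_matrix (A : Matrix ι ι ℂ) {c : ℂ} (hc : c ≠ 0) (hA : IsUnit A) :
    (c • A)⁻¹ = c⁻¹ • A⁻¹ := by
  apply inv_eq_left_inv
  rw [smul_mul_smul_comm, inv_mul_cancel₀ hc,
    nonsing_inv_mul _ ((isUnit_iff_isUnit_det _).1 hA), one_smul]

namespace IsNevanlinna

variable {f g : ℂ → Matrix ι ι ℂ} {b d s : Matrix ι ι ℂ}

/-- Removing the pole of `-s (f - b)⁻¹ s` at `0` yields a Nevanlinna function. -/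
theorem of_eq_inv_sub (hf : IsNevanlinna f) (hb : b.IsHermitian)
    (hu : ∀ z : ℂ, z.im ≠ 0 → IsUnit (f z - b))
    (hlim : Tendsto (fun y : ℝ => (y * I : ℂ)⁻¹ • (f (y * I) - b)) (𝓝[≠] 0) (𝓝 d))
    (hs : s.IsHermitian) (hsu : IsUnit s) (hsd : s * s = d)
    (hg : ∀ z : ℂ, z.im ≠ 0 → g z = z⁻¹ • 1 - s * (f z - b)⁻¹ * s) : IsNevanlinna g := by
  have hh := hf.neg_inv_sub hb hu
  have hz0 : ∀ z : ℂ, z.im ≠ 0 → z ≠ 0 := fun z hz h0 => hz (by simp [h0])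
  refine .of_quadratic ?_ ?_ ?_
  · refine differentiableOn_matrix_iff.2 fun i j => ?_
    have hd := differentiableOn_matrix_iff.1 hh.analytic
    have h1 : DifferentiableOn ℂ (fun z : ℂ => z⁻¹ * (1 : Matrix ι ι ℂ) i j -
        ∑ k, (∑ l, s i l * (f z - b)⁻¹ l k) * s k j) {z : ℂ | z.im ≠ 0} := by
      refine .sub (.mul_const (differentiableOn_id.inv hz0) _) (.fun_sum fun k _ => .mul_const
        (.fun_sum fun l _ => .const_mul ?_ _) _)
      simpa using (hd l k).neg
    refine h1.congr fun z hz => ?_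
    simp [hg z hz, mul_apply]
  · intro z hz
    have := hh.symm z hz
    rw [conjTranspose_neg, neg_inj] at this
    rw [hg z hz, hg _ (by simpa using hz), ← this]
    simp [conjTranspose_mul, hs.eq, mul_assoc]
  · intro z hz v
    have hs1 : s * d⁻¹ * s = 1 := by
      have := (isUnit_iff_isUnit_det s).1 hsu
      rw [← hsd, Matrix.mul_inv_rev, ← mul_assoc, mul_nonsing_inv _ this, one_mul,
        nonsing_inv_mul _ this]
    have hquad : ∀ A : Matrix ι ι ℂ, star (s *ᵥ v) ⬝ᵥ A *ᵥ s *ᵥ v = star v ⬝ᵥ (s * A * s) *ᵥ v := by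
      intro A
      rw [star_mulVec, hs.eq, ← dotProduct_mulVec, mulVec_mulVec, mulVec_mulVec, mul_assoc]
    obtain ⟨c, hc⟩ : ∃ c : ℝ, star v ⬝ᵥ v = c := by
      refine ⟨(star v ⬝ᵥ v).re, (conj_eq_iff_re.1 ?_).symm⟩
      rw [starRingEnd_apply, ← star_dotProduct]
    have hdu : IsUnit d := hsd ▸ hsu.mul hsu
    -- The mass at `0` of the form of `-(f - b)⁻¹` at `s v` is `v* s d⁻¹ s v = v* v = c`.
    have hlim' : Tendsto (fun y : ℝ => (y * I : ℂ) *
        (star (s *ᵥ v) ⬝ᵥ (-(f (y * I) - b)⁻¹) *ᵥ s *ᵥ v)) (𝓝[≠] 0) (𝓝 (-c)) := by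
      have hcont : Continuous fun A : Matrix ι ι ℂ => -(star (s *ᵥ v) ⬝ᵥ A *ᵥ s *ᵥ v) := by fun_prop
      have h1 := (hcont.tendsto _).comp (hlim.matrix_inv hdu)
      rw [hquad, hs1, one_mulVec, hc] at h1
      refine h1.congr' ?_
      filter_upwards [eventually_ofReal_mul_I_im_ne_zero] with y hy
      simp only [Function.comp_apply]
      rw [inv_smul_matrix _ (inv_ne_zero (hz0 _ hy)) (hu _ hy), inv_inv, smul_mulVec,
        dotProduct_smul, neg_mulVec, dotProduct_neg, smul_eq_mul, mul_neg]
    have key := (hh.quadratic (s *ᵥ v)).div_normSq_le_of_tendsto hlim' hz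
    have h2 : star v ⬝ᵥ g z *ᵥ v = z⁻¹ * c + star (s *ᵥ v) ⬝ᵥ (-(f z - b)⁻¹) *ᵥ s *ᵥ v := by
      rw [hg z hz, sub_mulVec, dotProduct_sub, smul_mulVec, dotProduct_smul, one_mulVec, hc,
        neg_mulVec, dotProduct_neg, hquad, smul_eq_mul, sub_eq_add_neg]
    rw [h2, add_im, add_div]
    -- The term `z⁻¹ c` takes away exactly the amount that Julia's lemma guarantees.
    have h3 : (z⁻¹ * c).im / z.im = -(c / normSq z) := by
      simp [inv_im]
      field_simp
    rw [h3]
    linarith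

/-- The transformation lowers the order of normal differentiability by two. -/
theorem hasNormalDerivs_of_eq_inv_sub (hf : IsNevanlinna f) {r : ℕ∞} (hr : 2 ≤ r)
    (hfr : HasNormalDerivs f 0 r) (hg : IsNevanlinna g)
    (hu : ∀ z : ℂ, z.im ≠ 0 → IsUnit (f z - b))
    (hb : Tendsto (fun y : ℝ => f (y * I)) (𝓝[≠] 0) (𝓝 b))
    (hlim : Tendsto (fun y : ℝ => (y * I : ℂ)⁻¹ • (f (y * I) - b)) (𝓝[≠] 0) (𝓝 d))
    (hsu : IsUnit s) (hsd : s * s = d)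
    (hgf : ∀ z : ℂ, z.im ≠ 0 → g z = z⁻¹ • (1 - s * (z⁻¹ • (f z - b))⁻¹ * s)) :
    HasNormalDerivs g 0 (r - 2) := by
  have hz0 : ∀ z : ℂ, z.im ≠ 0 → z ≠ 0 := fun z hz h0 => hz (by simp [h0])
  have hdf := differentiableOn_matrix_iff.1 hf.analytic
  have hdu : IsUnit d := hsd ▸ hsu.mul hsu
  have hs1 : s * d⁻¹ * s = 1 := by
    have := (isUnit_iff_isUnit_det s).1 hsu
    rw [← hsd, Matrix.mul_inv_rev, ← mul_assoc, mul_nonsing_inv _ this, one_mul, nonsing_inv_mul _ this]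
  have hdiv : ∀ h : ℂ → ℂ, DifferentiableOn ℂ h {z : ℂ | z.im ≠ 0} →
      DifferentiableOn ℂ (fun z => h z / z) {z : ℂ | z.im ≠ 0} := fun h hh =>
    hh.div differentiableOn_id hz0
  set P : ℂ → Matrix ι ι ℂ := fun z => z⁻¹ • (f z - b) with hP
  have hPe : ∀ i j, (fun z => P z i j) = fun z => (f z i j - b i j) / z := by
    intro i j
    funext z
    simp [hP, div_eq_inv_mul]
  have hPd : ∀ i j, DifferentiableOn ℂ (fun z => P z i j) {z : ℂ | z.im ≠ 0} := fun i j => by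
    rw [hPe]
    exact hdiv _ ((hdf i j).sub_const _)
  have hPu : ∀ z : ℂ, z.im ≠ 0 → IsUnit (P z) := fun z hz => by
    have h1 := (isUnit_iff_isUnit_det _).1 (hu z hz)
    rw [isUnit_iff_isUnit_det, det_smul]
    exact (IsUnit.mk0 _ (pow_ne_zero _ (inv_ne_zero (hz0 z hz)))).mul h1
  -- First loss of an order: `P` is a quotient by `z`. Inversion costs nothing because the limit `d`
  -- is invertible.
  have hnd : ∀ n : ℕ, ((n + 2 : ℕ) : ℕ∞) ≤ r →
      ∀ i j, NormallyDifferentiable (n + 1) (fun z => (P z)⁻¹ i j) := by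
    intro n hn
    refine NormallyDifferentiable.matrix_inv (fun i j => ?_) hPd hPu hlim hdu
    have h1 := ((hasNormalDerivs_iff (hdf i j)).1
      ((hasNormalDerivs_matrix_iff hf.analytic).1 hfr i j)).2 _ hn
    have h2 := h1.add (.const (n + 2) (-b i j)) (hdf i j) (by fun_prop)
    simp only [← sub_eq_add_neg] at h2
    rw [hPe]
    refine h2.div_id ((hdf i j).sub_const _) ?_
    simpa using (tendsto_matrix_iff.1 hb i j).sub_const (b i j)
  have hId := differentiableOn_matrix_inv hPd hPu
  -- `Q` is `1 - s P⁻¹ s` written out in scalar sums and products. It tends to `0`, so passing to `g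
  -- = Q / z` costs the second order.
  set Q : ι → ι → ℂ → ℂ := fun i j z =>
    (1 : Matrix ι ι ℂ) i j + ∑ k, (∑ l, s i l * (P z)⁻¹ l k) * (-s k j) with hQ
  have hQe : ∀ i j z, Q i j z = (1 - s * (P z)⁻¹ * s) i j := by
    intro i j z
    simp [hQ, mul_apply, sub_eq_add_neg]
  have hQd1 : ∀ i k, DifferentiableOn ℂ (fun z => ∑ l, s i l * (P z)⁻¹ l k)
      {z : ℂ | z.im ≠ 0} := fun i k => .fun_sum fun l _ => (hId l k).const_mul _
  have hQd2 : ∀ i j, DifferentiableOn ℂ (fun z => ∑ k, (∑ l, s i l * (P z)⁻¹ l k) * (-s k j))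
      {z : ℂ | z.im ≠ 0} := fun i j => .fun_sum fun k _ => (hQd1 i k).mul_const _
  have hQd : ∀ i j, DifferentiableOn ℂ (Q i j) {z : ℂ | z.im ≠ 0} := fun i j =>
    (hQd2 i j).const_add _
  have hQn : ∀ n : ℕ, ((n + 2 : ℕ) : ℕ∞) ≤ r → ∀ i j, NormallyDifferentiable (n + 1) (Q i j) := by
    intro n hn i j
    have h1 := hnd n hn
    refine (NormallyDifferentiable.const _ _).add ?_ (by fun_prop) (hQd2 i j)
    refine .sum _ (fun k _ => ?_) fun k _ => (hQd1 i k).mul_const _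
    refine .mul ?_ (.const _ _) (hQd1 i k) (by fun_prop)
    exact .sum _ (fun l _ => (NormallyDifferentiable.const _ _).mul (h1 l k) (by fun_prop)
      (hId l k)) fun l _ => (hId l k).const_mul _
  have hQ0 : ∀ i j, Tendsto (fun y : ℝ => Q i j (y * I)) (𝓝[≠] 0) (𝓝 0) := by
    intro i j
    have h1 : Tendsto (fun y : ℝ => 1 - s * (P (y * I))⁻¹ * s) (𝓝[≠] 0)
        (𝓝 (1 - s * d⁻¹ * s)) := by
      have hc : Continuous fun A : Matrix ι ι ℂ => 1 - s * A * s := by fun_prop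
      exact (hc.tendsto _).comp (hlim.matrix_inv hdu)
    rw [hs1, sub_self] at h1
    simpa only [hQe, Matrix.zero_apply] using tendsto_matrix_iff.1 h1 i j
  rw [hasNormalDerivs_matrix_iff hg.analytic]
  intro i j
  have hge : Set.EqOn (fun z => Q i j z / z) (fun z => g z i j) {z : ℂ | z.im ≠ 0} := by
    intro z hz
    simp only [hgf z hz, Matrix.smul_apply, smul_eq_mul, hQe, div_eq_inv_mul]
    rfl
  rw [hasNormalDerivs_iff (differentiableOn_matrix_iff.1 hg.analytic i j)]
  constructor
  -- The normal limit of `g` is the normal slope of `Q` at `0`; its existence uses `2 ≤ r`.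
  · obtain ⟨⟨a, c, hac⟩, -⟩ := hQn 0 (by simpa using hr) i j
    obtain rfl := tendsto_nhds_unique hac.1 (hQ0 i j)
    refine ⟨c, (hac.2.congr fun y => ?_).congr' (tendsto_congr_im_ne_zero hge)⟩
    rw [sub_zero, div_eq_inv_mul]
  · intro n hn
    refine ((hQn n ?_ i j).div_id (hQd i j) (hQ0 i j)).congr hge
    rw [Nat.cast_add, Nat.cast_ofNat]
    calc (n : ℕ∞) + 2 ≤ r - 2 + 2 := by gcongr
      _ = r := tsub_add_cancel_of_le hr

end IsNevanlinna

section Transform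

variable {f : ℂ → Matrix ι ι ℂ}

omit [DecidableEq ι] in
theorem nevanlinnaClass_mono {r r' : ℕ∞} (h : r' ≤ r) (hf : f ∈ nevanlinnaClass ι r 0) :
    f ∈ nevanlinnaClass ι r' 0 := ⟨hf.1, hf.2.mono h⟩

omit [Fintype ι] [DecidableEq ι] in
theorem HasNormalDerivs.tendsto_value {r : ℕ∞} (h : HasNormalDerivs f 0 r) :
    Tendsto (fun y : ℝ => f (y * I)) (𝓝[≠] 0) (𝓝 (normalDeriv f 0 0)) := by
  simpa only [normalQuotient_zero_zero] using h.tendsto 0 (by simp)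

omit [Fintype ι] [DecidableEq ι] in
theorem HasNormalDerivs.tendsto_quotient (h : HasNormalDerivs f 0 1) :
    Tendsto (fun y : ℝ => (y * I : ℂ)⁻¹ • (f (y * I) - normalDeriv f 0 0)) (𝓝[≠] 0)
      (𝓝 (normalDeriv f 0 1)) := by
  have := h.tendsto 1 (by simp)
  rwa [normalQuotient_zero_succ] at this

/-- Well-definedness of the transformation. -/
theorem schurTransform_wellDefined (hf : f ∈ nevanlinnaClass ι 1 0) (hn : IsNondegenerate f) :
    (normalDeriv f 0 0).IsHermitian ∧ (normalDeriv f 0 1).PosDef ∧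
      ∀ z : ℂ, z.im ≠ 0 → IsUnit (f z - normalDeriv f 0 0) := by
  have hb := hf.1.isHermitian_of_tendsto hf.2.tendsto_value
  exact ⟨hb, hf.1.posDef_of_tendsto hn hb hf.2.tendsto_quotient,
    fun z hz => hf.1.isUnit_sub hn hb hz⟩

theorem Matrix.PosDef.exists_sqrt {d : Matrix ι ι ℂ} (hd : d.PosDef) :
    (CFC.sqrt d).PosDef ∧ CFC.sqrt d * CFC.sqrt d = d := by
  have h1 : CFC.sqrt d * CFC.sqrt d = d :=
    CFC.sqrt_mul_sqrt_self d (nonneg_iff_posSemidef.2 hd.posSemidef)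
  refine ⟨?_, h1⟩
  have h2 : (CFC.sqrt d).PosSemidef := nonneg_iff_posSemidef.1 (CFC.sqrt_nonneg d)
  rw [h2.posDef_iff_det_ne_zero]
  intro h0
  apply det_ne_zero_of_isUnit hd.isUnit
  rw [← h1, det_mul, h0, zero_mul]

theorem schurTransform_eq (hf : f ∈ nevanlinnaClass ι 1 0) (hn : IsNondegenerate f) {z : ℂ}
    (hz : z.im ≠ 0) :
    schurTransform f z = z⁻¹ • (1 - z • (CFC.sqrt (normalDeriv f 0 1) *
      (f z - normalDeriv f 0 0)⁻¹ * CFC.sqrt (normalDeriv f 0 1))) := by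
  obtain ⟨-, hd, hu⟩ := schurTransform_wellDefined hf hn
  exact schur_expression_eq (hu z hz) hd.exists_sqrt.1.isUnit hd.exists_sqrt.2

theorem schurTransform'_eq (hf : f ∈ nevanlinnaClass ι 1 0) (hn : IsNondegenerate f) {z : ℂ}
    (hz : z.im ≠ 0) :
    schurTransform' f z = z⁻¹ • (1 - z • (CFC.sqrt (normalDeriv f 0 1) *
      (f z - normalDeriv f 0 0)⁻¹ * CFC.sqrt (normalDeriv f 0 1))) := by
  obtain ⟨-, hd, hu⟩ := schurTransform_wellDefined hf hn
  exact schur_expression'_eq (hu z hz) hd.exists_sqrt.1.isUnit hd.exists_sqrt.2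

theorem isNevanlinna_schurTransform (hf : f ∈ nevanlinnaClass ι 1 0) (hn : IsNondegenerate f) :
    IsNevanlinna (schurTransform f) := by
  obtain ⟨hb, hd, hu⟩ := schurTransform_wellDefined hf hn
  obtain ⟨hs, hsd⟩ := hd.exists_sqrt
  refine hf.1.of_eq_inv_sub hb hu hf.2.tendsto_quotient hs.isHermitian hs.isUnit hsd fun z hz => ?_
  have : z ≠ 0 := fun h0 => hz (by simp [h0])
  rw [schurTransform_eq hf hn hz, smul_sub, smul_smul, inv_mul_cancel₀ this, one_smul]

theorem schurTransform_mem_nevanlinnaClass {r : ℕ∞} (hr : 2 ≤ r) (hf : f ∈ nevanlinnaClass ι r 0)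
    (hn : IsNondegenerate f) : schurTransform f ∈ nevanlinnaClass ι (r - 2) 0 := by
  have hf1 : f ∈ nevanlinnaClass ι 1 0 :=
    nevanlinnaClass_mono (le_trans (by norm_num) hr) hf
  obtain ⟨hb, hd, hu⟩ := schurTransform_wellDefined hf1 hn
  obtain ⟨hs, hsd⟩ := hd.exists_sqrt
  have hg := isNevanlinna_schurTransform hf1 hn
  refine ⟨hg, hf.1.hasNormalDerivs_of_eq_inv_sub hr hf.2 hg hu hf.2.tendsto_value
    hf1.2.tendsto_quotient hs.isUnit hsd fun z hz => ?_⟩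
  have : z ≠ 0 := fun h0 => hz (by simp [h0])
  rw [schurTransform_eq hf1 hn hz, inv_smul_matrix _ (inv_ne_zero this) (hu z hz), inv_inv,
    Matrix.mul_smul, Matrix.smul_mul]

theorem schurStepDefined_of_isNondegenerate (hf : f ∈ nevanlinnaClass ι 1 0)
    (hn : IsNondegenerate f) : SchurStepDefined f := by
  obtain ⟨-, hd, hu⟩ := schurTransform_wellDefined hf hn
  obtain ⟨hs, hsd⟩ := hd.exists_sqrt
  exact ⟨hf.2, ⟨_, hs, by rw [pow_two, hsd]⟩, hu⟩

/-- On a kernel vector of `Im f(z)` the function agrees with its normal limit. -/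
theorem IsDegenerate.not_isUnit_sub (h : IsDegenerate f) (hf : f ∈ nevanlinnaClass ι 0 0) {z : ℂ}
    (hz : z.im ≠ 0) : ¬ IsUnit (f z - normalDeriv f 0 0) := by
  intro hu
  obtain ⟨v, hv0, hv⟩ := h z hz
  have h1 := hf.1.mulVec_eq_of_tendsto hf.2.tendsto_value hz hv hz
  rw [← sub_eq_zero, ← sub_mulVec] at h1
  exact hv0 ((mulVec_injective_iff_isUnit.2 hu) (by rw [h1, mulVec_zero]))

theorem schurStepDefined_iff (hf : f ∈ nevanlinnaClass ι 1 0) :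
    SchurStepDefined f ↔ IsNondegenerate f := by
  refine ⟨fun h => hf.1.not_isDegenerate_iff.1 fun hd => ?_, schurStepDefined_of_isNondegenerate hf⟩
  exact hd.not_isUnit_sub (nevanlinnaClass_mono (by simp) hf) (z := I) (by simp) (h.2.2 I (by simp))

end Transform

end

/-! ### The scalar transformation through 1 × 1 matrices. -/

section

open Complex ComplexConjugate

section Scalar

open scoped Matrix

variable {f : ℂ → ℂ}

theorem isUnit_smul_one_iff {c : ℂ} : IsUnit (c • (1 : Matrix Unit Unit ℂ)) ↔ c ≠ 0 := by
  rw [Matrix.isUnit_iff_isUnit_det]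
  simp

theorem star_dotProduct_smul_one_mulVec (c : ℂ) (v : Unit → ℂ) :
    star v ⬝ᵥ (c • (1 : Matrix Unit Unit ℂ)) *ᵥ v = (normSq (v ()) : ℂ) * c := by
  simp [dotProduct, Matrix.smul_mulVec, normSq_eq_conj_mul_self]
  ring

theorem IsScalarNevanlinna.smul_one (hf : IsScalarNevanlinna f) :
    IsNevanlinna (fun z => f z • (1 : Matrix Unit Unit ℂ)) := by
  refine .of_quadratic ?_ ?_ ?_
  · exact differentiableOn_matrix_iff.2 fun i j => by simpa using hf.analytic
  · intro z hz
    simp [← hf.symm z hz]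
  · intro z hz v
    rw [star_dotProduct_smul_one_mulVec, im_ofReal_mul, mul_div_assoc]
    exact mul_nonneg (normSq_nonneg _) (hf.nonneg z hz)

theorem IsNevanlinna.isScalarNevanlinna_apply {g : ℂ → Matrix Unit Unit ℂ} (hg : IsNevanlinna g) :
    IsScalarNevanlinna (fun z => g z () ()) := by
  simpa [dotProduct, Matrix.mulVec] using hg.quadratic (fun _ => 1)

/-- Needed because the matrix and scalar transforms are compared only off the real line. -/
theorem IsScalarNevanlinna.congr {g : ℂ → ℂ} (hf : IsScalarNevanlinna f)
    (h : Set.EqOn f g {z : ℂ | z.im ≠ 0}) : IsScalarNevanlinna g where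
  analytic := hf.analytic.congr h.symm
  symm z hz := by rw [← h hz, ← h (show (conj z).im ≠ 0 by simpa using hz), hf.symm z hz]
  nonneg z hz := by rw [← h hz]; exact hf.nonneg z hz

theorem HasNormalDerivs.congr {g : ℂ → ℂ} {r : ℕ∞} (hf : HasNormalDerivs f 0 r)
    (hd : DifferentiableOn ℂ f {z : ℂ | z.im ≠ 0})
    (h : Set.EqOn f g {z : ℂ | z.im ≠ 0}) : HasNormalDerivs g 0 r := by
  rw [hasNormalDerivs_iff hd] at hf
  rw [hasNormalDerivs_iff (hd.congr h.symm)]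
  obtain ⟨⟨a, ha⟩, hn⟩ := hf
  exact ⟨⟨a, ha.congr' (tendsto_congr_im_ne_zero h)⟩, fun n hr => (hn n hr).congr h⟩

theorem smul_one_mem_nevanlinnaClass {r : ℕ∞} (hf : f ∈ scalarNevanlinnaClass r 0) :
    (fun z => f z • (1 : Matrix Unit Unit ℂ)) ∈ nevanlinnaClass Unit r 0 :=
  ⟨hf.1.smul_one, (hasNormalDerivs_matrix_iff hf.1.smul_one.analytic).2 fun i j => by
    simpa using hf.2⟩

theorem normalDeriv_smul_one {r : ℕ∞} (hf : f ∈ scalarNevanlinnaClass r 0) (k : ℕ)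
    (hk : (k : ℕ∞) ≤ r) :
    normalDeriv (fun z => f z • (1 : Matrix Unit Unit ℂ)) 0 k = normalDeriv f 0 k • 1 :=
  normalDeriv_eq_of_tendsto (c := fun k => normalDeriv f 0 k • 1) (fun k hk =>
    (tendsto_normalQuotient_matrix_iff hf.1.smul_one.analytic _ _ k).2 fun i j => by
      simpa using hf.2.tendsto k hk) k hk

theorem isNondegenerate_smul_one (hf : IsScalarNevanlinna f) (h : ¬ IsScalarDegenerate f) :
    IsNondegenerate (fun z => f z • (1 : Matrix Unit Unit ℂ)) := by
  intro z hz v hv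
  rw [hf.smul_one.imaginaryPart_mulVec_eq_zero_iff hz, star_dotProduct_smul_one_mulVec,
    im_ofReal_mul, mul_eq_zero, normSq_eq_zero] at hv
  rcases hv with hv | hv
  · exact funext fun _ => hv
  · exact absurd ⟨z, hz, hv⟩ h

theorem IsScalarDegenerate.eq_normalDeriv (h : IsScalarDegenerate f) (hf : IsScalarNevanlinna f)
    {z : ℂ} (hz : z.im ≠ 0) : f z = normalDeriv f 0 0 := by
  obtain ⟨w, hw, hw0⟩ := h
  obtain ⟨c, hc⟩ := hf.exists_eq_const hw hw0
  rw [hc z hz]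
  refine (Tendsto.limUnder_eq ?_).symm
  rw [normalQuotient_zero_zero]
  refine tendsto_const_nhds.congr' ?_
  filter_upwards [eventually_ofReal_mul_I_im_ne_zero] with y hy using (hc _ hy).symm

theorem scalarSchurStepDefined_iff (hf : f ∈ scalarNevanlinnaClass 1 0) :
    ScalarSchurStepDefined f ↔ ¬ IsScalarDegenerate f := by
  constructor
  · intro h hd
    exact h.2.2 I (by simp) (sub_eq_zero.2 (hd.eq_normalDeriv hf.1 (by simp)))
  · intro h
    obtain ⟨-, hd, hu⟩ := schurTransform_wellDefined (smul_one_mem_nevanlinnaClass hf)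
      (isNondegenerate_smul_one hf.1 h)
    rw [normalDeriv_smul_one hf 1 (by simp)] at hd
    refine ⟨hf.2, ?_, fun z hz => ?_⟩
    · have h1 := hd.diag_pos (i := ())
      simp only [Matrix.smul_apply, Matrix.one_apply_eq, smul_eq_mul, mul_one] at h1
      obtain ⟨h2, h3⟩ := pos_iff.1 h1
      refine ⟨√(normalDeriv f 0 1).re, Real.sqrt_pos.2 h2, ?_⟩
      rw [← ofReal_pow, Real.sq_sqrt h2.le]
      exact Complex.ext rfl h3
    · have h1 := hu z hz
      rwa [normalDeriv_smul_one hf 0 (by simp), ← sub_smul, isUnit_smul_one_iff] at h1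

/-- Here `(f - b)⁻¹` is a multiple of the identity, so the two square roots meet and multiply to
`f'(0)`; the root itself need not be computed. -/
theorem schurTransform_smul_one_apply (hf : f ∈ scalarNevanlinnaClass 1 0)
    (h : ¬ IsScalarDegenerate f) {z : ℂ} (hz : z.im ≠ 0) :
    schurTransform (fun z => f z • (1 : Matrix Unit Unit ℂ)) z () () = scalarSchurTransform f z := by
  have hF := smul_one_mem_nevanlinnaClass hf
  have hn := isNondegenerate_smul_one hf.1 h
  have hu := ((scalarSchurStepDefined_iff hf).2 h).2.2 z hz
  obtain ⟨-, hd, -⟩ := schurTransform_wellDefined hF hn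
  have hs := hd.exists_sqrt.2
  rw [schurTransform_eq hF hn hz, normalDeriv_smul_one hf 0 (by simp), ← sub_smul,
    inv_smul_matrix _ hu isUnit_one, inv_one]
  set s := CFC.sqrt (normalDeriv (fun z => f z • (1 : Matrix Unit Unit ℂ)) 0 1)
  rw [Matrix.mul_smul, Matrix.smul_mul, mul_one, hs, normalDeriv_smul_one hf 1 (by simp)]
  simp only [scalarSchurTransform, Matrix.smul_apply, Matrix.sub_apply, Matrix.one_apply_eq,
    smul_eq_mul, mul_one]
  field_simp

theorem scalarSchurTransform_mem {r : ℕ∞} (hr : 2 ≤ r) (hf : f ∈ scalarNevanlinnaClass r 0)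
    (h : ¬ IsScalarDegenerate f) : scalarSchurTransform f ∈ scalarNevanlinnaClass (r - 2) 0 := by
  have hf1 : f ∈ scalarNevanlinnaClass 1 0 := ⟨hf.1, hf.2.mono (le_trans (by norm_num) hr)⟩
  obtain ⟨hg, hgr⟩ := schurTransform_mem_nevanlinnaClass hr (smul_one_mem_nevanlinnaClass hf)
    (isNondegenerate_smul_one hf.1 h)
  have he : Set.EqOn (fun z => schurTransform (fun z => f z • (1 : Matrix Unit Unit ℂ)) z () ())
      (scalarSchurTransform f) {z : ℂ | z.im ≠ 0} := fun z hz =>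
    schurTransform_smul_one_apply hf1 h hz
  exact ⟨hg.isScalarNevanlinna_apply.congr he,
    ((hasNormalDerivs_matrix_iff hg.analytic).1 hgr () ()).congr
      hg.isScalarNevanlinna_apply.analytic he⟩

end Scalar

end

/-! ### Partial iterations and the final assembly. -/

open Classical in
/-- A partial iteration which ends exactly at the elements satisfying `Deg`. -/
theorem partialIterate_spec {α : Type*} {D Deg C : α → Prop} {T : α → α} {u : ℕ → Option α} {f : α}
    (h0 : u 0 = some f)
    (hs : ∀ n, u (n + 1) = (u n).bind fun g => if D g then some (T g) else none) (hf : C f)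
    (hD : ∀ g, C g → (D g ↔ ¬ Deg g)) (hT : ∀ g, C g → ¬ Deg g → C (T g)) :
    (∀ n g, u n = some g → C g ∧ (u (n + 1) = none ↔ Deg g)) ∧
      ((∃ n, u n = none) ↔ ∃ n g, u n = some g ∧ Deg g) := by
  have hC : ∀ n g, u n = some g → C g := by
    intro n
    induction n with
    | zero =>
      intro g hg
      rw [h0, Option.some_inj] at hg
      exact hg ▸ hf
    | succ n ih =>
      intro g hg
      rw [hs, Option.bind_eq_some_iff] at hg
      obtain ⟨g', hg', hg⟩ := hg
      split_ifs at hg with hDg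
      rw [Option.some_inj] at hg
      exact hg ▸ hT g' (ih g' hg') ((hD g' (ih g' hg')).1 hDg)
  have hhalt : ∀ n g, u n = some g → (u (n + 1) = none ↔ Deg g) := by
    intro n g hg
    rw [hs, hg, Option.bind_some, ← not_iff_not, ← hD g (hC n g hg)]
    split_ifs with h <;> simp [h]
  refine ⟨fun n g hg => ⟨hC n g hg, hhalt n g hg⟩, ?_, ?_⟩
  · rintro ⟨n, hn⟩
    -- Going down from an index with value `none` reaches the last iterate generated, which
    -- satisfies `Deg`.
    induction n with
    | zero => simp [h0] at hn
    | succ n ih =>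
      cases hu : u n with
      | none => exact ih hu
      | some g => exact ⟨n, g, hu, (hhalt n g hu).1 hn⟩
  · rintro ⟨n, g, hg, hd⟩
    exact ⟨n + 1, (hhalt n g hg).2 hd⟩

end

theorem mainTheorem4 {ι : Type*} [Fintype ι] [DecidableEq ι] :
    -- the transformation is well defined, with two equal expressions, and (i)
    (∀ f : ℂ → Matrix ι ι ℂ, f ∈ nevanlinnaClass ι 1 0 → IsNondegenerate f →
      (normalDeriv f 0 0).IsHermitian ∧ (normalDeriv f 0 1).PosDef ∧
      (∀ z : ℂ, z.im ≠ 0 → IsUnit (f z - normalDeriv f 0 0)) ∧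
      (∀ z : ℂ, z.im ≠ 0 → schurTransform f z = schurTransform' f z) ∧
      IsNevanlinna (schurTransform f)) ∧
    -- (ii)
    (∀ (r : ℕ∞) (f : ℂ → Matrix ι ι ℂ), 2 ≤ r → f ∈ nevanlinnaClass ι r 0 → IsNondegenerate f →
      schurTransform f ∈ nevanlinnaClass ι (r - 2) 0) ∧
    -- the matrix Schur algorithm
    (∀ f : ℂ → Matrix ι ι ℂ, f ∈ nevanlinnaClass ι ⊤ 0 →
      (∀ (n : ℕ) (g : ℂ → Matrix ι ι ℂ), matrixSchurIterate f n = some g →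
        g ∈ nevanlinnaClass ι ⊤ 0 ∧
        (matrixSchurIterate f (n + 1) = none ↔ IsDegenerate g) ∧
        (IsDegenerate g → ∀ z : ℂ, z.im ≠ 0 → ¬ IsUnit (g z - normalDeriv g 0 0))) ∧
      ((∃ n : ℕ, matrixSchurIterate f n = none) ↔
        ∃ (n : ℕ) (g : ℂ → Matrix ι ι ℂ), matrixSchurIterate f n = some g ∧ IsDegenerate g)) ∧
    -- the scalar Schur algorithm
    (∀ f : ℂ → ℂ, f ∈ scalarNevanlinnaClass ⊤ 0 →
      (∀ (n : ℕ) (g : ℂ → ℂ), scalarSchurIterate f n = some g →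
        g ∈ scalarNevanlinnaClass ⊤ 0 ∧
        (scalarSchurIterate f (n + 1) = none ↔ IsScalarDegenerate g) ∧
        (IsScalarDegenerate g → ∀ z : ℂ, z.im ≠ 0 → g z = normalDeriv g 0 0)) ∧
      ((∃ n : ℕ, scalarSchurIterate f n = none) ↔
        ∃ (n : ℕ) (g : ℂ → ℂ), scalarSchurIterate f n = some g ∧ IsScalarDegenerate g)) := by
  refine ⟨fun f hf hn => ?_, fun r f hr hf hn => schurTransform_mem_nevanlinnaClass hr hf hn,
    fun f hf => ?_, fun f hf => ?_⟩
  · obtain ⟨hb, hd, hu⟩ := schurTransform_wellDefined hf hn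
    exact ⟨hb, hd, hu, fun z hz => by rw [schurTransform_eq hf hn hz, schurTransform'_eq hf hn hz],
      isNevanlinna_schurTransform hf hn⟩
  · obtain ⟨h1, h2⟩ := partialIterate_spec (u := matrixSchurIterate f) (D := SchurStepDefined)
      (Deg := IsDegenerate) (C := (· ∈ nevanlinnaClass ι ⊤ 0)) (T := schurTransform) rfl
      (fun _ => rfl) hf
      (fun g hg => by
        rw [schurStepDefined_iff (nevanlinnaClass_mono le_top hg), hg.1.not_isDegenerate_iff])
      -- Since `⊤ - 2 = ⊤`, the class of infinite order is preserved by each step.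
      (fun g hg hd => by
        simpa using schurTransform_mem_nevanlinnaClass le_top hg (hg.1.not_isDegenerate_iff.1 hd))
    exact ⟨fun n g hg => ⟨(h1 n g hg).1, (h1 n g hg).2, fun hd z hz =>
      hd.not_isUnit_sub (nevanlinnaClass_mono le_top (h1 n g hg).1) hz⟩, h2⟩
  · obtain ⟨h1, h2⟩ := partialIterate_spec (u := scalarSchurIterate f) (D := ScalarSchurStepDefined)
      (Deg := IsScalarDegenerate) (C := (· ∈ scalarNevanlinnaClass ⊤ 0))
      (T := scalarSchurTransform) rfl (fun _ => rfl) hf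
      (fun g hg => scalarSchurStepDefined_iff ⟨hg.1, hg.2.mono le_top⟩)
      (fun g hg hd => by simpa using scalarSchurTransform_mem le_top hg hd)
    exact ⟨fun n g hg => ⟨(h1 n g hg).1, (h1 n g hg).2, fun hd z hz =>
      hd.eq_normalDeriv (h1 n g hg).1.1 hz⟩, h2⟩
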